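/- **Theorem.** Let $j>2$ and $1\le a<j$ be integers with $\gcd(a,j)=1$. For $n\ge 0$ and $z\in\mathbb C$ put $$Q_n(z)=\sum_{\lambda}z^{\ell(\lambda)},$$ the sum over all partitions $\lambda$ of $n$ all of whose parts are congruent to $a$ modulo $j$, where $\ell(\lambda)$ is the number of parts of $\lambda$. Let $\mathrm{Li}_2(z)=\sum_{m\ge1}z^m/m^2$, let $$S_j=\{z\in\mathbb C:\ 0<|z|<1,\ |\arg z|<\pi/j\},$$ and for $z\in S_j$ and $n\ge 1$ put $$R_n(z)=(1-z)^{\frac{2a-j}{2j}}\left(\frac{\mathrm{Li}_2(z)}{16j\pi^2n^3}\right)^{1/4}\exp\left(2\sqrt{\frac{n\,\mathrm{Li}_2(z)}{j}}\right),$$ with all powers and roots principal. 1. For every compact $X\subset S_j$, $Q_n(z)\sim R_n(z)$ as $n\to\infty$ uniformly for $z\in X$, that is, $Q_n(z)/R_n(z)\to1$ uniformly on $X$. 2. For all $n\ge0$ and $z\in\mathbb C$, $\;Q_n(e^{2\pi i a/j}z)=e^{2\pi i n/j}Q_n(z)$. 3. Consequently, for every integer $t$ and every compact $X\subset e^{2\pi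 i ta/j}S_j$, $\;Q_n(z)\sim e^{2\pi i tn/j}R_n(e^{-2\pi i ta/j}z)$ as $n\to\infty$, uniformly for $z\in X$. -/

import Mathlib

open Filter Set

/-- The weighted count of the partitions of `n` all of whose parts are congruent to `a` modulo `j`,
each partition `p` being counted with weight `z ^ (number of parts of p)`. -/
def weightedPartitionCount (a j n : ℕ) (z : ℂ) : ℂ :=
  ∑ p : n.Partition with ∀ i ∈ p.parts, i ≡ a [MOD j], z ^ p.parts.card

/-- The dilogarithm `Li₂(z) = ∑_{m ≥ 1} z ^ m / m ^ 2` (the series converges for `‖z‖ ≤ 1`). -/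
noncomputable def dilog (z : ℂ) : ℂ :=
  ∑' m : ℕ, z ^ (m + 1) / ((m : ℂ) + 1) ^ 2

/-- The sector `|arg z| < π / j` of the punctured open unit disk. -/
def openSector (j : ℕ) : Set ℂ :=
  {z : ℂ | z ≠ 0 ∧ ‖z‖ < 1 ∧ |z.arg| < Real.pi / j}

/-- The main term
`(1 - z) ^ ((2a - j) / (2j)) * (Li₂(z) / (16 j π² n³)) ^ (1/4) * exp (2 √(n Li₂(z) / j))`;
all powers are principal. -/
noncomputable def mainTerm (a j n : ℕ) (z : ℂ) : ℂ :=
  (1 - z) ^ ((2 * (a : ℂ) - j) / (2 * j)) *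
    (dilog z / (16 * j * (Real.pi : ℂ) ^ 2 * (n : ℂ) ^ 3)) ^ (1 / 4 : ℂ) *
    Complex.exp (2 * (n * dilog z / j) ^ (1 / 2 : ℂ))

open scoped Topology ComplexConjugate

/-! The proof is a circle method kept uniform in $z$. At $q=e^{-s}$ the generating function is
$\exp(\sum_{m\ge1}\frac{z^m}{m}\kappa(ms))$ with $\kappa(s)=e^{-as}/(1-e^{-js})$. Since
$\kappa(s)=\frac1{js}+(\frac12-\frac aj)+o(1)$ at $0$, the exponent is
$\frac{\mathrm{Li}_2(z)}{js}-(\frac12-\frac aj)\log(1-z)+o(1)$ when $s\to0$ inside a sector. In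
Cauchy's integral this meets the factor $e^{ns}$; the saddle is $s=A/\sqrt n$ with
$A=\sqrt{\mathrm{Li}_2(z)/j}$. The Gaussian integral there (`tendsto_major_arc`) produces $R_n$, the
power of $1-z$ coming from the constant term of $\kappa$.

The real issue is that nothing else on the circle competes. Shifting $s$ by $2\pi ik/j$ amounts to
replacing $z$ by $ze^{-2\pi ika/j}$ (`logGen_add_rotation`), so the circle becomes $j$ copies of the
arc $|\mathrm{Im}\,s|\le\pi/j$, with rotated weights $w$. The polar term satisfies
$\mathrm{Re}\frac{\mathrm{Li}_2(w)}{js}\le\frac{H(w)}{j\,\mathrm{Re}\,s}$ with $H=$ `dilogHeight`,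
and equality holds at the saddle. Two inequalities are therefore needed.

First, $H(w)<H(z)$ for every nontrivial rotation: $H$ strictly decreases in $|\arg|$ on circles
(`dilogHeight_strictAntiOn`), and a point of the sector has strictly larger real part than its
rotations (`re_rotation_mul_lt`). Second, away from $\mathrm{Im}\,s=0$ only those $m$ for which $ms$
approaches a pole of $\kappa$ matter; they are multiples of some $d\ge2$ and contribute at most
$\frac{\pi^2}{24}|z|^2$ in place of $H$. This is below $H(z)$ when $|\arg z|\le\pi/3$
(`lt_dilogHeight`), which is where $j>2$ enters.

All limits are taken along a filter on which $z$ varies too. With the filter `atTop ×ˢ 𝓝 z₀` this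
gives local uniformity, hence uniformity on compact sets. The rotation identity is the congruence
$\ell(\lambda)a\equiv n$ modulo $j$, and it carries the first claim to the third. -/

/-! ### Monotonicity of the dilogarithm along circles -/

theorem nonneg_of_hasDerivAt_nonneg {f f' : ℝ → ℝ} (h0 : f 0 = 0)
    (hc : ContinuousOn f (Icc 0 1)) (hd : ∀ t ∈ Ioo (0 : ℝ) 1, HasDerivAt f (f' t) t)
    (hn : ∀ t ∈ Ioo (0 : ℝ) 1, 0 ≤ f' t) {t : ℝ} (ht : t ∈ Icc (0 : ℝ) 1) : 0 ≤ f t := by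
  have hm : MonotoneOn f (Icc 0 1) := by
    refine monotoneOn_of_deriv_nonneg (convex_Icc 0 1) hc ?_ ?_
    · intro s hs
      rw [interior_Icc] at hs
      exact (hd s hs).differentiableAt.differentiableWithinAt
    · intro s hs
      rw [interior_Icc] at hs
      rw [(hd s hs).deriv]
      exact hn s hs
  rw [← h0]
  exact hm (left_mem_Icc.2 zero_le_one) ht ht.1

theorem HasDerivAt.complex_im {f : ℝ → ℂ} {f' : ℂ} {t : ℝ} (h : HasDerivAt f f' t) :
    HasDerivAt (fun s => (f s).im) f'.im t :=
  Complex.imCLM.hasFDerivAt.comp_hasDerivAt t h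

theorem HasDerivAt.complex_re {f : ℝ → ℂ} {f' : ℂ} {t : ℝ} (h : HasDerivAt f f' t) :
    HasDerivAt (fun s => (f s).re) f'.re t :=
  Complex.reCLM.hasFDerivAt.comp_hasDerivAt t h

/-- The derivative of the dilogarithm in the open unit disk. -/
noncomputable def dilogDeriv (z : ℂ) : ℂ := ∑' m : ℕ, z ^ m / ((m : ℂ) + 1)

theorem summable_dilog {z : ℂ} (hz : ‖z‖ ≤ 1) :
    Summable fun m : ℕ => z ^ (m + 1) / ((m : ℂ) + 1) ^ 2 := by
  have h : Summable fun m : ℕ => 1 / ((m : ℝ) + 1) ^ 2 := by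
    exact_mod_cast (summable_nat_add_iff 1).2 (Real.summable_one_div_nat_pow.2 one_lt_two)
  refine .of_norm_bounded h fun m => ?_
  have : ‖((m : ℂ) + 1)‖ = (m : ℝ) + 1 := by
    exact_mod_cast Complex.norm_natCast (m + 1)
  rw [norm_div, norm_pow, norm_pow, this]
  gcongr
  exact pow_le_one₀ (norm_nonneg _) hz

theorem hasDerivAt_dilog {z : ℂ} (hz : ‖z‖ < 1) : HasDerivAt dilog (dilogDeriv z) z := by
  obtain ⟨r, hr, hr1⟩ := exists_between hz
  have hr0 : 0 < r := (norm_nonneg z).trans_lt hr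
  refine hasDerivAt_tsum_of_isPreconnected (u := fun m : ℕ => r ^ m) (t := Metric.ball 0 r) (y₀ := 0)
    (summable_geometric_of_lt_one hr0.le hr1) Metric.isOpen_ball
    (convex_ball (0 : ℂ) r).isPreconnected (g := fun m z => z ^ (m + 1) / ((m : ℂ) + 1) ^ 2)
    (g' := fun m z => z ^ m / ((m : ℂ) + 1)) ?_ ?_ (by simpa) ?_ (by simpa)
  · intro m y _
    have hm : (m : ℂ) + 1 ≠ 0 := Nat.cast_add_one_ne_zero m
    refine ((hasDerivAt_pow (m + 1) y).div_const (((m : ℂ) + 1) ^ 2)).congr_deriv ?_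
    push_cast
    field_simp
  · intro m y hy
    have : ‖((m : ℂ) + 1)‖ = (m : ℝ) + 1 := by
      exact_mod_cast Complex.norm_natCast (m + 1)
    rw [norm_div, norm_pow, this]
    have hy' : ‖y‖ ≤ r := by simpa using (mem_ball_zero_iff.1 hy).le
    calc ‖y‖ ^ m / ((m : ℝ) + 1) ≤ ‖y‖ ^ m := div_le_self (by positivity) (by simp)
      _ ≤ r ^ m := by gcongr
  · exact summable_dilog (by simp)

theorem mul_dilogDeriv {z : ℂ} (hz : ‖z‖ < 1) : z * dilogDeriv z = -Complex.log (1 - z) := by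
  rw [← (Complex.hasSum_taylorSeries_neg_log' hz).tsum_eq, dilogDeriv, ← tsum_mul_left]
  congr 1; ext m
  rw [pow_succ]; ring

theorem dilog_zero : dilog 0 = 0 := by simp [dilog]

theorem one_sub_mem_slitPlane {z : ℂ} (hz : ‖z‖ < 1) : 1 - z ∈ Complex.slitPlane := by
  left
  have := (Complex.re_le_norm z).trans_lt hz
  simp [this]

theorem one_sub_ne_zero_of_norm_lt_one {z : ℂ} (hz : ‖z‖ < 1) : 1 - z ≠ 0 :=
  Complex.slitPlane_ne_zero (one_sub_mem_slitPlane hz)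

theorem norm_ofReal_mul_lt_one {z : ℂ} (hz : ‖z‖ < 1) {t : ℝ} (ht : t ∈ Icc (0 : ℝ) 1) :
    ‖(t : ℂ) * z‖ < 1 := by
  rw [norm_mul, Complex.norm_real, Real.norm_of_nonneg ht.1]
  exact (mul_le_of_le_one_left (norm_nonneg z) ht.2).trans_lt hz

theorem hasDerivAt_ofReal_mul (z : ℂ) (t : ℝ) : HasDerivAt (fun s : ℝ => (s : ℂ) * z) z t := by
  simpa using (Complex.ofRealCLM.hasDerivAt (x := t)).mul_const z

theorem hasDerivAt_dilog_ofReal_mul {z : ℂ} (hz : ‖z‖ < 1) {t : ℝ} (ht : t ∈ Icc (0 : ℝ) 1) :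
    HasDerivAt (fun s : ℝ => dilog (s * z)) (dilogDeriv (t * z) * z) t :=
  HasDerivAt.comp (h₂ := dilog) (h := fun s : ℝ => (s : ℂ) * z) t
    (hasDerivAt_dilog (norm_ofReal_mul_lt_one hz ht)) (hasDerivAt_ofReal_mul z t)

theorem hasDerivAt_neg_log_one_sub_ofReal_mul {z : ℂ} (hz : ‖z‖ < 1) {t : ℝ}
    (ht : t ∈ Icc (0 : ℝ) 1) :
    HasDerivAt (fun s : ℝ => -Complex.log (1 - s * z)) (z / (1 - t * z)) t := by
  have h := (((hasDerivAt_ofReal_mul z t).const_sub 1).clog_real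
    (one_sub_mem_slitPlane (norm_ofReal_mul_lt_one hz ht))).neg
  rwa [neg_div, neg_neg] at h

/-- The $t$-derivative is a positive multiple of $\overline{(1-z)}(1-tz)$, whose imaginary part is
$(1-t)\,\mathrm{Im}\,z$. This starts a chain of argument comparisons between $z/(1-z)$, $-\log(1-z)$
and $\mathrm{Li}_2(z)$, each step integrating the previous one along a ray. -/
theorem im_mul_conj_neg_log_nonneg {z : ℂ} (hz : ‖z‖ < 1) (hi : 0 ≤ z.im) {t : ℝ}
    (ht : t ∈ Icc (0 : ℝ) 1) :
    0 ≤ (z / (1 - z) * conj (-Complex.log (1 - t * z))).im := by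
  have hd : ∀ t ∈ Icc (0 : ℝ) 1, HasDerivAt
      (fun t : ℝ => (z / (1 - z) * conj (-Complex.log (1 - t * z))).im)
      (z / (1 - z) * conj (z / (1 - t * z))).im t := fun t ht =>
    ((hasDerivAt_neg_log_one_sub_ofReal_mul hz ht).star.const_mul (z / (1 - z))).complex_im
  refine nonneg_of_hasDerivAt_nonneg (by simp) (fun t ht => (hd t ht).continuousAt.continuousWithinAt)
    (fun t ht => hd t (Ioo_subset_Icc_self ht)) (fun t ht => ?_) ht
  have h1 := one_sub_ne_zero_of_norm_lt_one hz
  have h2 := one_sub_ne_zero_of_norm_lt_one (norm_ofReal_mul_lt_one hz (Ioo_subset_Icc_self ht))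
  have h3 : conj (1 - (t : ℂ) * z) ≠ 0 := (map_ne_zero _).2 h2
  have key : z / (1 - z) * conj (z / (1 - t * z)) =
      (((Complex.normSq z / (Complex.normSq (1 - z) * Complex.normSq (1 - t * z)) : ℝ)) : ℂ) *
        (conj (1 - z) * (1 - t * z)) := by
    push_cast
    rw [Complex.normSq_eq_conj_mul_self, Complex.normSq_eq_conj_mul_self,
      Complex.normSq_eq_conj_mul_self, map_div₀]
    have h4 : conj (1 - z) ≠ 0 := (map_ne_zero _).2 h1
    rw [div_mul_div_comm, div_mul_eq_mul_div, div_eq_div_iff (mul_ne_zero h1 h3)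
      (mul_ne_zero (mul_ne_zero h4 h1) (mul_ne_zero h3 h2))]
    ring
  rw [key, Complex.im_ofReal_mul]
  refine mul_nonneg (div_nonneg (Complex.normSq_nonneg _)
    (mul_nonneg (Complex.normSq_nonneg _) (Complex.normSq_nonneg _))) ?_
  simp
  nlinarith [ht.1, ht.2, mul_nonneg hi (sub_nonneg.2 ht.2.le)]

theorem im_mul_conj_dilog_nonneg {z : ℂ} (hz : ‖z‖ < 1) (hi : 0 ≤ z.im) {t : ℝ}
    (ht : t ∈ Icc (0 : ℝ) 1) :
    0 ≤ (z / (1 - z) * conj (dilog (t * z))).im := by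
  have hd : ∀ t ∈ Icc (0 : ℝ) 1, HasDerivAt
      (fun t : ℝ => (z / (1 - z) * conj (dilog (t * z))).im)
      (z / (1 - z) * conj (dilogDeriv (t * z) * z)).im t := fun t ht =>
    ((hasDerivAt_dilog_ofReal_mul hz ht).star.const_mul (z / (1 - z))).complex_im
  refine nonneg_of_hasDerivAt_nonneg (by simp [dilog_zero])
    (fun t ht => (hd t ht).continuousAt.continuousWithinAt)
    (fun t ht => hd t (Ioo_subset_Icc_self ht)) (fun t ht => ?_) ht
  have h := im_mul_conj_neg_log_nonneg hz hi (Ioo_subset_Icc_self ht)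
  rw [← mul_dilogDeriv (norm_ofReal_mul_lt_one hz (Ioo_subset_Icc_self ht))] at h
  have e : z / (1 - z) * conj ((t : ℂ) * z * dilogDeriv (t * z)) =
      (t : ℂ) * (z / (1 - z) * conj (dilogDeriv (t * z) * z)) := by
    simp only [map_mul, Complex.conj_ofReal]; ring
  rw [e, Complex.im_ofReal_mul] at h
  exact nonneg_of_mul_nonneg_right h ht.1

/-- Differentiating along the ray and multiplying by $t$ gives the previous comparison at $tz$ plus
the real number $|\log(1-tz)|^2$. The quantity is $-\frac12$ times the angular derivative of
$|\mathrm{Li}_2|^2$. -/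
theorem im_neg_log_mul_conj_dilog_nonneg {z : ℂ} (hz : ‖z‖ < 1) (hi : 0 ≤ z.im) :
    0 ≤ (-Complex.log (1 - z) * conj (dilog z)).im := by
  have hd : ∀ t ∈ Icc (0 : ℝ) 1, HasDerivAt
      (fun t : ℝ => (-Complex.log (1 - t * z) * conj (dilog (t * z))).im)
      (z / (1 - t * z) * conj (dilog (t * z)) +
        -Complex.log (1 - t * z) * conj (dilogDeriv (t * z) * z)).im t := fun t ht =>
    ((hasDerivAt_neg_log_one_sub_ofReal_mul hz ht).mul
      (hasDerivAt_dilog_ofReal_mul hz ht).star).complex_im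
  have h := nonneg_of_hasDerivAt_nonneg (by simp [dilog_zero])
    (fun t ht => (hd t ht).continuousAt.continuousWithinAt)
    (fun t ht => hd t (Ioo_subset_Icc_self ht)) (fun t ht => ?_) (right_mem_Icc.2 zero_le_one)
  · simpa using h
  have ht' := Ioo_subset_Icc_self ht
  have htz := norm_ofReal_mul_lt_one hz ht'
  have h1 := im_mul_conj_dilog_nonneg htz (by simpa using mul_nonneg ht.1.le hi)
    (right_mem_Icc.2 zero_le_one)
  refine nonneg_of_mul_nonneg_right (a := t) ?_ ht.1
  rw [← Complex.im_ofReal_mul]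
  have e : (t : ℂ) * (z / (1 - t * z) * conj (dilog (t * z)) +
        -Complex.log (1 - t * z) * conj (dilogDeriv (t * z) * z)) =
      (t * z) / (1 - t * z) * conj (dilog (t * z)) +
        -Complex.log (1 - t * z) * conj (-Complex.log (1 - t * z)) := by
    rw [← mul_dilogDeriv htz]
    simp only [map_mul, Complex.conj_ofReal]; ring
  rw [e, Complex.mul_conj, Complex.add_im, Complex.ofReal_im, add_zero]
  simpa using h1

theorem dilog_conj (z : ℂ) : dilog (conj z) = conj (dilog z) := by
  rw [dilog, dilog, Complex.conj_tsum]
  congr 1; ext m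
  simp

/-- The square of the real part of the principal square root of `dilog z`. -/
noncomputable def dilogHeight (z : ℂ) : ℝ := (‖dilog z‖ + (dilog z).re) / 2

theorem dilogHeight_conj (z : ℂ) : dilogHeight (conj z) = dilogHeight z := by
  simp [dilogHeight, dilog_conj]

theorem hasDerivAt_dilog_circle {r : ℝ} (hr0 : 0 ≤ r) (hr : r < 1) (θ : ℝ) :
    HasDerivAt (fun t : ℝ => dilog (r * Complex.exp (t * Complex.I)))
      (Complex.I * -Complex.log (1 - r * Complex.exp (θ * Complex.I))) θ := by
  have hn : ‖(r : ℂ) * Complex.exp (θ * Complex.I)‖ < 1 := by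
    simpa [Complex.norm_exp_ofReal_mul_I, abs_of_nonneg hr0] using hr
  have h1 : HasDerivAt (fun t : ℝ => (r : ℂ) * Complex.exp (t * Complex.I))
      (r * (Complex.exp (θ * Complex.I) * Complex.I)) θ :=
    (hasDerivAt_ofReal_mul Complex.I θ).cexp.const_mul _
  refine (HasDerivAt.comp (h₂ := dilog) θ (hasDerivAt_dilog hn) h1).congr_deriv ?_
  rw [← mul_dilogDeriv hn]
  ring

/-- Both summands decrease on the upper half circle: the real part strictly, having angular
derivative $\arg(1-z)<0$, and the modulus weakly, by `im_neg_log_mul_conj_dilog_nonneg`. -/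
theorem dilogHeight_strictAntiOn {r : ℝ} (hr0 : 0 < r) (hr : r < 1) :
    StrictAntiOn (fun t : ℝ => dilogHeight (r * Complex.exp (t * Complex.I)))
      (Icc 0 Real.pi) := by
  have hd := hasDerivAt_dilog_circle hr0.le hr
  have hn : ∀ t : ℝ, ‖(r : ℂ) * Complex.exp (t * Complex.I)‖ < 1 := fun t => by
    simpa [Complex.norm_exp_ofReal_mul_I, abs_of_nonneg hr0.le] using hr
  have him : ∀ t : ℝ, ((r : ℂ) * Complex.exp (t * Complex.I)).im = r * Real.sin t := fun t => by
    rw [Complex.im_ofReal_mul, Complex.exp_ofReal_mul_I_im]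
  have h1 : StrictAntiOn (fun t : ℝ => (dilog (r * Complex.exp (t * Complex.I))).re)
      (Icc 0 Real.pi) := by
    refine strictAntiOn_of_deriv_neg (convex_Icc _ _)
      (fun t _ => (hd t).complex_re.continuousAt.continuousWithinAt) fun t ht => ?_
    rw [interior_Icc] at ht
    rw [(hd t).complex_re.deriv]
    have hs := Real.sin_pos_of_pos_of_lt_pi ht.1 ht.2
    have : Complex.arg (1 - r * Complex.exp (t * Complex.I)) < 0 := by
      rw [Complex.arg_neg_iff, Complex.sub_im, him, Complex.one_im]
      nlinarith
    rw [Complex.I_mul_re, Complex.neg_im, Complex.log_im]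
    simpa using this
  have h2 : AntitoneOn (fun t : ℝ => Complex.normSq (dilog (r * Complex.exp (t * Complex.I))))
      (Icc 0 Real.pi) := by
    have hd2 : ∀ t : ℝ, HasDerivAt
        (fun t : ℝ => Complex.normSq (dilog (r * Complex.exp (t * Complex.I))))
        (-2 * (-Complex.log (1 - r * Complex.exp (t * Complex.I)) *
          conj (dilog (r * Complex.exp (t * Complex.I)))).im) t := by
      intro t
      have h := ((hd t).mul (hd t).star).complex_re
      have e : (fun t : ℝ => Complex.normSq (dilog (r * Complex.exp (t * Complex.I)))) =
          fun t : ℝ => (dilog (r * Complex.exp (t * Complex.I)) *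
            star (dilog (r * Complex.exp (t * Complex.I)))).re := by
        ext t
        rw [Complex.star_def, Complex.mul_conj, Complex.ofReal_re]
      rw [e]
      refine h.congr_deriv ?_
      simp [Complex.mul_re, Complex.mul_im]
      ring
    refine antitoneOn_of_deriv_nonpos (convex_Icc _ _)
      (fun t _ => (hd2 t).continuousAt.continuousWithinAt)
      (fun t _ => (hd2 t).differentiableAt.differentiableWithinAt) fun t ht => ?_
    rw [interior_Icc] at ht
    rw [(hd2 t).deriv]
    have hs := Real.sin_pos_of_pos_of_lt_pi ht.1 ht.2
    have := im_neg_log_mul_conj_dilog_nonneg (hn t) (by rw [him]; positivity)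
    linarith
  intro s hs t ht hst
  have a1 := h1 hs ht hst
  have a2 := Real.sqrt_le_sqrt (h2 hs ht hst.le)
  simp only [dilogHeight, Complex.norm_def] at *
  linarith

theorem dilogHeight_eq_abs_arg (z : ℂ) :
    dilogHeight z = dilogHeight (‖z‖ * Complex.exp ((|z.arg| : ℝ) * Complex.I)) := by
  rcases le_total 0 z.arg with h | h
  · rw [abs_of_nonneg h, Complex.norm_mul_exp_arg_mul_I]
  · rw [abs_of_nonpos h, ← dilogHeight_conj z]
    conv_lhs => rw [← Complex.norm_mul_exp_arg_mul_I z]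
    rw [map_mul, Complex.conj_ofReal, ← Complex.exp_conj]
    simp

theorem dilogHeight_lt_of_abs_arg_lt {z w : ℂ} (hz0 : z ≠ 0) (hz : ‖z‖ < 1) (hw : ‖w‖ = ‖z‖)
    (h : |z.arg| < |w.arg|) : dilogHeight w < dilogHeight z := by
  rw [dilogHeight_eq_abs_arg z, dilogHeight_eq_abs_arg w, hw]
  exact dilogHeight_strictAntiOn (norm_pos_iff.2 hz0) hz
    ⟨abs_nonneg _, Complex.abs_arg_le_pi _⟩ ⟨abs_nonneg _, Complex.abs_arg_le_pi _⟩ h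

theorem dilogHeight_lt_of_re_lt {z w : ℂ} (hz : ‖z‖ < 1) (hw : ‖w‖ = ‖z‖)
    (h : w.re < z.re) : dilogHeight w < dilogHeight z := by
  have hz0 : z ≠ 0 := by
    rintro rfl
    rw [norm_zero, norm_eq_zero] at hw
    simp [hw] at h
  refine dilogHeight_lt_of_abs_arg_lt hz0 hz hw ?_
  by_contra hc
  have := Real.cos_le_cos_of_nonneg_of_le_pi (abs_nonneg _) (Complex.abs_arg_le_pi _) (not_lt.1 hc)
  rw [Real.cos_abs, Real.cos_abs] at this
  have h1 := mul_le_mul_of_nonneg_left this (norm_nonneg z)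
  rw [Complex.norm_mul_cos_arg, ← hw, Complex.norm_mul_cos_arg] at h1
  linarith

/-! ### A lower bound for the height when the argument is at most π/3 -/

theorem hasSum_one_div_succ_sq : HasSum (fun m : ℕ => 1 / ((m : ℝ) + 1) ^ 2) (Real.pi ^ 2 / 6) := by
  have h := (hasSum_nat_add_iff' 1).2 hasSum_zeta_two
  simpa using h

theorem abs_re_pow_mul_le (m : ℕ) :
    |(Complex.exp ((Real.pi / 3 : ℝ) * Complex.I) ^ m *
      (1 + Complex.exp (-((Real.pi / 3 : ℝ) * Complex.I)))).re| ≤ 3 / 2 := by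
  set w := Complex.exp ((Real.pi / 3 : ℝ) * Complex.I) with hw
  have hre : w.re = 1 / 2 := by rw [hw, Complex.exp_ofReal_mul_I_re, Real.cos_pi_div_three]
  have him : w.im = √3 / 2 := by rw [hw, Complex.exp_ofReal_mul_I_im, Real.sin_pi_div_three]
  have hu : Complex.exp (-((Real.pi / 3 : ℝ) * Complex.I)) = conj w := by
    rw [hw, ← Complex.exp_conj, map_mul, Complex.conj_ofReal, Complex.conj_I, mul_neg]
  have h3 : w ^ 3 = -1 := by
    rw [hw, ← Complex.exp_nat_mul, ← Complex.exp_pi_mul_I]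
    congr 1; push_cast; ring
  have h4 : √3 * √3 = 3 := Real.mul_self_sqrt (by norm_num)
  rw [hu]
  have hs : ∀ s < 3, |(w ^ s * (1 + conj w)).re| ≤ 3 / 2 := by
    intro s hs
    interval_cases s
    · simp [hre]; norm_num
    · simp [hre, him]
      rw [abs_le]; constructor <;> nlinarith
    · simp [hre, him, pow_two]
      rw [abs_le]; constructor <;> nlinarith
  rw [← Nat.div_add_mod m 3, pow_add, pow_mul, h3]
  rcases neg_one_pow_eq_or ℂ (m / 3) with h | h <;> rw [h]
  · simpa only [one_mul] using hs _ (Nat.mod_lt _ (by norm_num))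
  · have := hs _ (Nat.mod_lt m (show 0 < 3 by norm_num))
    rwa [neg_mul, one_mul, neg_mul, Complex.neg_re, abs_neg]

/-- With $L=\mathrm{Li}_2(rw)$, $w=e^{i\pi/3}$, one has $2H\ge\mathrm{Re}(L\bar w)+\mathrm{Re}\,L$,
which is linear in $L$. Its series has coefficients $\cos\frac{(m+1)\pi}3+\cos\frac{m\pi}3$, equal
to $\frac32$ and $0$ for $m=0,1$ and at least $-\frac32$ afterwards. -/
theorem lt_dilogHeight_pi_div_three {r : ℝ} (hr0 : 0 < r) (hr : r < 1) :
    Real.pi ^ 2 / 24 * r ^ 2 <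
      dilogHeight (r * Complex.exp ((Real.pi / 3 : ℝ) * Complex.I)) := by
  set w := Complex.exp ((Real.pi / 3 : ℝ) * Complex.I) with hw
  set u := 1 + Complex.exp (-((Real.pi / 3 : ℝ) * Complex.I)) with hu
  have hre : w.re = 1 / 2 := by rw [hw, Complex.exp_ofReal_mul_I_re, Real.cos_pi_div_three]
  have him : w.im = √3 / 2 := by rw [hw, Complex.exp_ofReal_mul_I_im, Real.sin_pi_div_three]
  have hcw : Complex.exp (-((Real.pi / 3 : ℝ) * Complex.I)) = conj w := by
    rw [hw, ← Complex.exp_conj, map_mul, Complex.conj_ofReal, Complex.conj_I, mul_neg]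
  have h4 : √3 * √3 = 3 := Real.mul_self_sqrt (by norm_num)
  have hwn : ‖w‖ = 1 := by rw [hw, Complex.norm_exp_ofReal_mul_I]
  have hzn : ‖(r : ℂ) * w‖ = r := by simp [hwn, abs_of_pos hr0]
  have hsum : HasSum (fun m : ℕ => (w ^ (m + 1) * u).re * (r ^ (m + 1) / ((m : ℝ) + 1) ^ 2))
      (dilog (r * w) * u).re := by
    have h := Complex.hasSum_re ((summable_dilog (z := r * w) (hzn.trans_lt hr).le).hasSum.mul_right u)
    refine h.congr_fun fun m => ?_
    have e : ((r : ℂ) * w) ^ (m + 1) / ((m : ℂ) + 1) ^ 2 * u =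
        ((r ^ (m + 1) / ((m : ℝ) + 1) ^ 2 : ℝ) : ℂ) * (w ^ (m + 1) * u) := by
      push_cast; rw [mul_pow]; ring
    rw [e, Complex.re_ofReal_mul, mul_comm]
  have hle : (dilog (r * w) * u).re ≤ 2 * dilogHeight (r * w) := by
    have h1 : (dilog (r * w) * conj w).re ≤ ‖dilog (r * w)‖ := by
      refine (Complex.re_le_norm _).trans ?_
      rw [norm_mul, Complex.norm_conj, hwn, mul_one]
    rw [hu, hcw, mul_add, mul_one, Complex.add_re, dilogHeight]
    linarith
  -- The corrections $2$ and $\frac14$ turn $-1/(m+1)^2$ into the exact values $1$ and $0$ at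
  -- $m=0,1$; every later power of $r$ is replaced by $r$.
  have hlow : HasSum (fun m : ℕ => 3 / 2 * r * ((if m = 0 then 2 else 0) +
      (if m = 1 then 1 / 4 else 0) - 1 / ((m : ℝ) + 1) ^ 2))
      (3 / 2 * r * (2 + 1 / 4 - Real.pi ^ 2 / 6)) :=
    (((hasSum_ite_eq 0 (2 : ℝ)).add (hasSum_ite_eq 1 (1 / 4 : ℝ))).sub
      hasSum_one_div_succ_sq).mul_left _
  have hcmp := hasSum_le (fun m => ?_) hlow hsum
  -- What is needed is $\frac32(\frac94-\frac{\pi^2}6)\ge\frac{\pi^2}{12}$, that is $\pi^2\le81/8$.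
  · have hp : Real.pi ^ 2 < 10 := by nlinarith [Real.pi_lt_d2, Real.pi_pos]
    nlinarith [mul_pos hr0 (sub_pos.2 hr), mul_pos hr0 (sub_pos.2 hp), mul_pos (mul_pos hr0 hr0) (sub_pos.2 hp)]
  · rcases m with _ | _ | m
    · have : (w * u).re = 3 / 2 := by
        rw [hu, hcw]; simp [hre, him]; nlinarith
      simp [this]; nlinarith
    · have : (w ^ 2 * u).re = 0 := by
        rw [hu, hcw]; simp [hre, him, pow_two]; nlinarith
      simp [this]; norm_num
    · have h1 := (abs_le.1 (abs_re_pow_mul_le (m + 1 + 1 + 1))).1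
      rw [← hw, ← hu] at h1
      have h2 : r ^ (m + 1 + 1 + 1) / (((m + 1 + 1 : ℕ) : ℝ) + 1) ^ 2 ≤
          r / (((m + 1 + 1 : ℕ) : ℝ) + 1) ^ 2 := by
        gcongr
        exact pow_le_of_le_one hr0.le hr.le (by simp)
      have h3 : 0 ≤ r ^ (m + 1 + 1 + 1) / (((m + 1 + 1 : ℕ) : ℝ) + 1) ^ 2 := by positivity
      have e : 3 / 2 * r * ((if m + 1 + 1 = 0 then (2 : ℝ) else 0) +
        (if m + 1 + 1 = 1 then 1 / 4 else 0) - 1 / (((m + 1 + 1 : ℕ) : ℝ) + 1) ^ 2) =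
          -(3 / 2) * (r / (((m + 1 + 1 : ℕ) : ℝ) + 1) ^ 2) := by
        simp; ring
      rw [e]
      nlinarith

theorem lt_dilogHeight {z : ℂ} (hz0 : z ≠ 0) (hz : ‖z‖ < 1) (harg : |z.arg| ≤ Real.pi / 3) :
    Real.pi ^ 2 / 24 * ‖z‖ ^ 2 < dilogHeight z := by
  have h0 := norm_pos_iff.2 hz0
  refine (lt_dilogHeight_pi_div_three h0 hz).trans_le ?_
  rw [dilogHeight_eq_abs_arg z]
  exact (dilogHeight_strictAntiOn h0 hz).antitoneOn ⟨abs_nonneg _, Complex.abs_arg_le_pi _⟩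
    ⟨by positivity, by linarith [Real.pi_pos]⟩ harg

/-! ### The kernel and the logarithm of the generating function near s = 0 -/

/-- The Laplace-side kernel `exp (-a s) / (1 - exp (-j s)) = ∑ₘ exp (-(a + j m) s)`. -/
noncomputable def partKernel (a j : ℕ) (s : ℂ) : ℂ :=
  Complex.exp (-(a * s)) / (1 - Complex.exp (-(j * s)))

/-- The kernel without its polar part at `0`. -/
noncomputable def regKernel (a j : ℕ) (s : ℂ) : ℂ := partKernel a j s - 1 / (j * s)

theorem norm_exp_neg_natCast_mul (j : ℕ) (s : ℂ) :
    ‖Complex.exp (-(j * s))‖ = Real.exp (-(j * s.re)) := by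
  rw [Complex.norm_exp]; simp

theorem norm_exp_neg_natCast_mul_lt_one {j : ℕ} (hj : 0 < j) {s : ℂ} (hs : 0 < s.re) :
    ‖Complex.exp (-(j * s))‖ < 1 := by
  rw [norm_exp_neg_natCast_mul, Real.exp_lt_one_iff]
  have : (0 : ℝ) < j := by exact_mod_cast hj
  nlinarith [mul_pos this hs]

theorem norm_partKernel_le (a : ℕ) {j : ℕ} (hj : 0 < j) {s : ℂ} (hs : 0 < s.re) :
    ‖partKernel a j s‖ ≤ 1 / (j * s.re) + 1 := by
  have hj' : (0 : ℝ) < j := by exact_mod_cast hj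
  have hv : 0 < j * s.re := mul_pos hj' hs
  have h1 : 1 - Real.exp (-(j * s.re)) ≤ ‖1 - Complex.exp (-(j * s))‖ := by
    have := norm_sub_norm_le 1 (Complex.exp (-(j * s)))
    rwa [norm_one, norm_exp_neg_natCast_mul] at this
  have h2 : Real.exp (-(j * s.re)) ≤ 1 / (1 + j * s.re) := by
    rw [Real.exp_neg, ← one_div]
    exact one_div_le_one_div_of_le (by positivity) (by linarith [Real.add_one_le_exp (j * s.re)])
  have h3 : (j * s.re) / (1 + j * s.re) ≤ ‖1 - Complex.exp (-(j * s))‖ := by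
    refine le_trans ?_ h1
    have : (j * s.re) / (1 + j * s.re) = 1 - 1 / (1 + j * s.re) := by field_simp; ring
    linarith
  have h4 : ‖Complex.exp (-(a * s))‖ ≤ 1 := by
    rw [norm_exp_neg_natCast_mul, Real.exp_le_one_iff]
    have : (0 : ℝ) ≤ a := by positivity
    nlinarith [mul_nonneg this hs.le]
  rw [partKernel, norm_div]
  calc _ ≤ 1 / ((j * s.re) / (1 + j * s.re)) := by gcongr
    _ = _ := by field_simp

theorem norm_regKernel_le (a : ℕ) {j : ℕ} (hj : 0 < j) {s : ℂ} (hs : 0 < s.re) :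
    ‖regKernel a j s‖ ≤ 2 / (j * s.re) + 1 := by
  have hj' : (0 : ℝ) < j := by exact_mod_cast hj
  have h1 : ‖1 / ((j : ℂ) * s)‖ ≤ 1 / (j * s.re) := by
    rw [norm_div, norm_one, norm_mul, Complex.norm_natCast]
    gcongr
    exact Complex.re_le_norm s
  have h2 := norm_partKernel_le a hj hs
  calc _ ≤ ‖partKernel a j s‖ + ‖1 / ((j : ℂ) * s)‖ := norm_sub_le _ _
    _ ≤ (1 / (j * s.re) + 1) + 1 / (j * s.re) := add_le_add h2 h1
    _ = _ := by ring

theorem tendsto_exp_mul_sub_one_div (c : ℂ) :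
    Tendsto (fun s : ℂ => (Complex.exp (c * s) - 1) / s) (𝓝[≠] 0) (𝓝 c) := by
  have h : HasDerivAt (fun s : ℂ => Complex.exp (c * s)) c 0 := by
    have := ((hasDerivAt_id (0 : ℂ)).const_mul c).cexp
    simpa using this
  have := h.tendsto_slope
  refine this.congr fun s => ?_
  simp [slope_def_field]

theorem tendsto_exp_mul_sub_one_sub_div_sq (c : ℂ) :
    Tendsto (fun s : ℂ => (Complex.exp (c * s) - 1 - c * s) / s ^ 2) (𝓝[≠] 0) (𝓝 (c ^ 2 / 2)) := by
  have h1 : Tendsto (fun s : ℂ => c * s) (𝓝 0) (𝓝 0) := by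
    have : Continuous (fun s : ℂ => c * s) := by fun_prop
    simpa using this.tendsto 0
  have h2 : (fun s : ℂ => Complex.exp (c * s) - 1 - c * s - (c * s) ^ 2 / 2) =O[𝓝 0]
      fun s => (c * s) ^ 3 := by
    have := (Complex.exp_sub_sum_range_isBigO_pow 3).comp_tendsto h1
    refine this.congr_left fun s => ?_
    simp [Finset.sum_range_succ, Nat.factorial]
    ring
  have h3 : (fun s : ℂ => (c * s) ^ 3) =O[𝓝 0] fun s => s ^ 3 := by
    simp_rw [mul_pow]
    exact Asymptotics.isBigO_const_mul_self _ _ _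
  have h4 : (fun s : ℂ => s ^ 3) =o[𝓝 0] fun s => s ^ 2 :=
    Asymptotics.isLittleO_pow_pow (by norm_num)
  have h5 := ((h2.trans h3).trans_isLittleO h4).tendsto_div_nhds_zero.mono_left
    (nhdsWithin_le_nhds (s := {0}ᶜ))
  have h6 := h5.add_const (c ^ 2 / 2)
  rw [zero_add] at h6
  refine h6.congr' ?_
  filter_upwards [self_mem_nhdsWithin] with s hs
  have hs : s ≠ 0 := hs
  field_simp
  ring

theorem tendsto_regKernel (a : ℕ) {j : ℕ} (hj : 0 < j) :
    Tendsto (regKernel a j) (𝓝[≠] 0) (𝓝 (1 / 2 - a / j)) := by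
  have hj' : (j : ℂ) ≠ 0 := by exact_mod_cast hj.ne'
  have h1 := (tendsto_exp_mul_sub_one_div (-a)).const_mul (j : ℂ)
  have h2 := tendsto_exp_mul_sub_one_sub_div_sq (-j)
  have h3 := (tendsto_exp_mul_sub_one_div (-j)).const_mul (-j : ℂ)
  -- Numerator and denominator of $\frac{jse^{-as}-(1-e^{-js})}{js(1-e^{-js})}$ are each divided by
  -- $s^2$.
  have h4 := (h1.add h2).div h3 (by simpa using hj')
  have e : ((j : ℂ) * -a + (-j) ^ 2 / 2) / (-j * -j) = 1 / 2 - a / j := by field_simp; ring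
  rw [e] at h4
  refine h4.congr' ?_
  have hne : ∀ᶠ s : ℂ in 𝓝[≠] 0, -(j : ℂ) * ((Complex.exp (-j * s) - 1) / s) ≠ 0 :=
    h3.eventually_ne (by simpa using hj')
  filter_upwards [self_mem_nhdsWithin, hne] with s hs hs2
  have hs : s ≠ 0 := hs
  have hE : 1 - Complex.exp (-(j * s)) ≠ 0 := by
    intro h
    apply hs2
    have : Complex.exp (-j * s) - 1 = 0 := by rw [neg_mul, ← neg_eq_zero, ← h]; ring
    rw [this]; simp
  have hE2 : Complex.exp (-(j * s)) - 1 ≠ 0 := by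
    intro h; apply hE; rw [← neg_eq_zero, ← h]; ring
  simp only [Pi.div_apply, regKernel, partKernel, neg_mul]
  field_simp
  ring

/-- Near $0$ the limit bounds the kernel; away from $0$ the sector condition keeps $\mathrm{Re}\,s$
bounded below. Sectors are stable under $s\mapsto(m+1)s$, so one constant serves all terms of the
series. -/
theorem exists_norm_regKernel_le_of_sector (a : ℕ) {j : ℕ} (hj : 0 < j) {K : ℝ} (hK : 0 ≤ K) :
    ∃ C, 0 ≤ C ∧ ∀ s : ℂ, 0 < s.re → |s.im| ≤ K * s.re → ‖regKernel a j s‖ ≤ C := by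
  have hj' : (0 : ℝ) < j := by exact_mod_cast hj
  have h := (tendsto_regKernel a hj).norm.eventually_le_const
    (lt_add_one ‖(1 / 2 - a / j : ℂ)‖)
  rw [eventually_nhdsWithin_iff, Metric.eventually_nhds_iff] at h
  obtain ⟨ρ, hρ, h⟩ := h
  refine ⟨max (‖(1 / 2 - a / j : ℂ)‖ + 1) (2 / (j * (ρ / (1 + K))) + 1),
    le_max_of_le_left (by positivity), fun s hs hs2 => ?_⟩
  by_cases hsr : ‖s‖ < ρ
  · refine le_max_of_le_left (h (by simpa using hsr) ?_)
    rintro rfl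
    simp at hs
  · refine le_max_of_le_right ((norm_regKernel_le a hj hs).trans ?_)
    have h1 := Complex.norm_le_abs_re_add_abs_im s
    rw [abs_of_pos hs] at h1
    have h2 : ρ / (1 + K) ≤ s.re := by
      rw [div_le_iff₀ (by positivity)]
      nlinarith
    have : 0 < ρ / (1 + K) := by positivity
    gcongr

/-- The logarithm of the generating function `∏ₘ (1 - w q ^ (a + j m))⁻¹` at `q = exp (-s)`. -/
noncomputable def logGen (a j : ℕ) (w s : ℂ) : ℂ :=
  ∑' m : ℕ, w ^ (m + 1) / ((m : ℂ) + 1) * partKernel a j (((m : ℂ) + 1) * s)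

theorem natCast_add_one_mul_re (m : ℕ) (s : ℂ) : (((m : ℂ) + 1) * s).re = ((m : ℝ) + 1) * s.re := by
  have : ((m : ℂ) + 1) = (((m : ℝ) + 1 : ℝ) : ℂ) := by push_cast; rfl
  rw [this, Complex.re_ofReal_mul]

theorem natCast_add_one_mul_im (m : ℕ) (s : ℂ) : (((m : ℂ) + 1) * s).im = ((m : ℝ) + 1) * s.im := by
  have : ((m : ℂ) + 1) = (((m : ℝ) + 1 : ℝ) : ℂ) := by push_cast; rfl
  rw [this, Complex.im_ofReal_mul]

theorem natCast_add_one_mul_re_pos (m : ℕ) {s : ℂ} (hs : 0 < s.re) :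
    0 < (((m : ℂ) + 1) * s).re := by
  rw [natCast_add_one_mul_re]; positivity

theorem norm_natCast_add_one (m : ℕ) : ‖((m : ℂ) + 1)‖ = (m : ℝ) + 1 := by
  exact_mod_cast Complex.norm_natCast (m + 1)

theorem norm_pow_succ_div_le (w : ℂ) (m : ℕ) :
    ‖w ^ (m + 1) / ((m : ℂ) + 1)‖ ≤ ‖w‖ ^ (m + 1) := by
  rw [norm_div, norm_pow, norm_natCast_add_one]
  exact div_le_self (by positivity) (by simp)

theorem norm_partKernel_succ_mul_le (a : ℕ) {j : ℕ} (hj : 0 < j) (m : ℕ) {s : ℂ} (hs : 0 < s.re) :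
    ‖partKernel a j (((m : ℂ) + 1) * s)‖ ≤ 1 / (j * s.re) + 1 := by
  refine (norm_partKernel_le a hj (natCast_add_one_mul_re_pos m hs)).trans ?_
  rw [natCast_add_one_mul_re]
  have hj' : (0 : ℝ) < j := by exact_mod_cast hj
  gcongr
  exact le_mul_of_one_le_left hs.le (by simp)

theorem norm_regKernel_succ_mul_le (a : ℕ) {j : ℕ} (hj : 0 < j) (m : ℕ) {s : ℂ} (hs : 0 < s.re) :
    ‖regKernel a j (((m : ℂ) + 1) * s)‖ ≤ 2 / (j * s.re) + 1 := by
  refine (norm_regKernel_le a hj (natCast_add_one_mul_re_pos m hs)).trans ?_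
  rw [natCast_add_one_mul_re]
  have hj' : (0 : ℝ) < j := by exact_mod_cast hj
  gcongr
  exact le_mul_of_one_le_left hs.le (by simp)

theorem summable_pow_succ {r : ℝ} (h0 : 0 ≤ r) (h1 : r < 1) : Summable fun m : ℕ => r ^ (m + 1) :=
  (summable_nat_add_iff 1).2 (summable_geometric_of_lt_one h0 h1)

theorem summable_pow_succ_div_mul {f : ℕ → ℂ} {C : ℝ} (hf : ∀ m, ‖f m‖ ≤ C) {w : ℂ} (hw : ‖w‖ < 1) :
    Summable fun m : ℕ => w ^ (m + 1) / ((m : ℂ) + 1) * f m := by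
  refine .of_norm_bounded ((summable_pow_succ (norm_nonneg w) hw).mul_right C) fun m => ?_
  rw [norm_mul]
  exact mul_le_mul (norm_pow_succ_div_le w m) (hf m) (norm_nonneg _) (by positivity)

theorem norm_tsum_pow_succ_div_mul_le {f : ℕ → ℂ} {C r : ℝ} (hf : ∀ m, ‖f m‖ ≤ C) {w : ℂ}
    (hw : ‖w‖ ≤ r) (hr : r < 1) :
    ‖∑' m : ℕ, w ^ (m + 1) / ((m : ℂ) + 1) * f m‖ ≤ (∑' m : ℕ, r ^ (m + 1)) * C := by
  have hr0 := (norm_nonneg w).trans hw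
  rw [← tsum_mul_right]
  refine tsum_of_norm_bounded ((summable_pow_succ hr0 hr).mul_right C).hasSum fun m => ?_
  rw [norm_mul]
  refine mul_le_mul ((norm_pow_succ_div_le w m).trans ?_) (hf m) (norm_nonneg _) (by positivity)
  gcongr

theorem logGen_sub_eq_tsum (a : ℕ) {j : ℕ} (hj : 0 < j) {w s : ℂ} (hw : ‖w‖ < 1) (hs : 0 < s.re) :
    logGen a j w s - dilog w / (j * s) =
      ∑' m : ℕ, w ^ (m + 1) / ((m : ℂ) + 1) * regKernel a j (((m : ℂ) + 1) * s) := by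
  have h1 := summable_pow_succ_div_mul (fun m => norm_partKernel_succ_mul_le a hj m hs) hw
  have h2 := (summable_dilog hw.le).div_const ((j : ℂ) * s)
  rw [logGen, dilog, ← tsum_div_const, ← h1.tsum_sub h2]
  congr 1; ext m
  have hm : (m : ℂ) + 1 ≠ 0 := Nat.cast_add_one_ne_zero m
  have hj' : (j : ℂ) ≠ 0 := by exact_mod_cast hj.ne'
  have hs' : s ≠ 0 := by rintro rfl; simp at hs
  rw [regKernel]
  field_simp

section Limits

variable {ι : Type*} {l : Filter ι}

theorem tendsto_tsum_pow_succ_div_mul {w : ι → ℂ} {w₀ : ℂ} (hw : Tendsto w l (𝓝 w₀))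
    (hw₀ : ‖w₀‖ < 1) {f : ι → ℕ → ℂ} {f₀ : ℕ → ℂ} (hf : ∀ m, Tendsto (f · m) l (𝓝 (f₀ m))) {C : ℝ}
    (hC : ∀ᶠ i in l, ∀ m, ‖f i m‖ ≤ C) :
    Tendsto (fun i => ∑' m : ℕ, w i ^ (m + 1) / ((m : ℂ) + 1) * f i m) l
      (𝓝 (∑' m : ℕ, w₀ ^ (m + 1) / ((m : ℂ) + 1) * f₀ m)) := by
  obtain ⟨r, hr, hr1⟩ := exists_between hw₀
  have hr0 := (norm_nonneg w₀).trans hr.le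
  refine tendsto_tsum_of_dominated_convergence (bound := fun m => r ^ (m + 1) * C)
    ((summable_pow_succ hr0 hr1).mul_right C) (fun m => ?_) ?_
  · exact ((hw.pow (m + 1)).div_const _).mul (hf m)
  · filter_upwards [hC, hw.norm.eventually_lt_const hr] with i hi hir m
    rw [norm_mul]
    refine mul_le_mul ((norm_pow_succ_div_le _ m).trans ?_) (hi m) (norm_nonneg _) (by positivity)
    gcongr

/-- The regular part of `logGen` near `s = 0` inside a sector. -/
theorem tendsto_logGen_sub_of_sector (a : ℕ) {j : ℕ} (hj : 0 < j) {w s : ι → ℂ} {w₀ : ℂ}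
    (hw : Tendsto w l (𝓝 w₀)) (hw₀ : ‖w₀‖ < 1) (hs : Tendsto s l (𝓝 0))
    (hs0 : ∀ᶠ i in l, 0 < (s i).re) {K : ℝ} (hK : 0 ≤ K)
    (hsK : ∀ᶠ i in l, |(s i).im| ≤ K * (s i).re) :
    Tendsto (fun i => logGen a j (w i) (s i) - dilog (w i) / (j * s i)) l
      (𝓝 ((1 / 2 - a / j) * -Complex.log (1 - w₀))) := by
  obtain ⟨C, hC0, hC⟩ := exists_norm_regKernel_le_of_sector a hj hK
  have h := tendsto_tsum_pow_succ_div_mul hw hw₀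
    (f := fun i m => regKernel a j (((m : ℂ) + 1) * s i)) (f₀ := fun _ => 1 / 2 - a / j) ?_
    (C := C) ?_
  · rw [tsum_mul_right, (Complex.hasSum_taylorSeries_neg_log' hw₀).tsum_eq, mul_comm] at h
    refine h.congr' ?_
    filter_upwards [hs0, hw.norm.eventually_lt_const hw₀] with i hi hwi
    rw [logGen_sub_eq_tsum a hj hwi hi]
  · intro m
    refine (tendsto_regKernel a hj).comp (tendsto_nhdsWithin_iff.2 ⟨?_, ?_⟩)
    · simpa using hs.const_mul ((m : ℂ) + 1)
    · filter_upwards [hs0] with i hi h0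
      have := natCast_add_one_mul_re_pos m hi
      rw [h0] at this
      simp at this
  · filter_upwards [hs0, hsK] with i h0 hK m
    refine hC _ (natCast_add_one_mul_re_pos m h0) ?_
    rw [natCast_add_one_mul_im, natCast_add_one_mul_re, abs_mul, abs_of_pos (by positivity)]
    nlinarith [mul_le_mul_of_nonneg_left hK (show (0 : ℝ) ≤ (m : ℝ) + 1 by positivity)]

variable {x α t : ι → ℝ} {α₀ : ℝ} {w : ι → ℂ} {w₀ : ℂ}

/-- Here $s$ may approach $0$ tangentially to the imaginary axis, so the sector bound is not
available. The factor $x$, comparable to $\mathrm{Re}\,s$, makes up for it: $x$ times the regular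
kernel is bounded uniformly in $m$ and tends to $0$ for each $m$. -/
theorem tendsto_mul_logGen_sub_zero (a : ℕ) {j : ℕ} (hj : 0 < j) (hx : Tendsto x l (𝓝[>] 0))
    (hα : Tendsto α l (𝓝 α₀)) (hα₀ : 0 < α₀) (hw : Tendsto w l (𝓝 w₀)) (hw₀ : ‖w₀‖ < 1)
    (ht : Tendsto t l (𝓝 0)) :
    Tendsto (fun i => (x i : ℂ) * (logGen a j (w i) (x i * α i + t i * Complex.I) -
      dilog (w i) / (j * (x i * α i + t i * Complex.I)))) l (𝓝 0) := by
  have hx0 : ∀ᶠ i in l, 0 < x i := hx.eventually self_mem_nhdsWithin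
  have hx' : Tendsto x l (𝓝 0) := hx.mono_right nhdsWithin_le_nhds
  have hα' : ∀ᶠ i in l, α₀ / 2 < α i := hα.eventually_const_lt (by linarith)
  have hxc : Tendsto (fun i => (x i : ℂ)) l (𝓝 0) := by
    exact_mod_cast (Complex.continuous_ofReal.tendsto 0).comp hx'
  have hs : Tendsto (fun i => (x i * α i + t i * Complex.I : ℂ)) l (𝓝 0) := by
    have h1 := hxc.mul ((Complex.continuous_ofReal.tendsto α₀).comp hα)
    have h2 := ((Complex.continuous_ofReal.tendsto 0).comp ht).mul_const Complex.I
    simpa using h1.add h2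
  have hre : ∀ i, (x i * α i + t i * Complex.I : ℂ).re = x i * α i := fun i => by simp
  have hj' : (0 : ℝ) < j := by exact_mod_cast hj
  have h := tendsto_tsum_pow_succ_div_mul hw hw₀
    (f := fun i m => x i * regKernel a j (((m : ℂ) + 1) * (x i * α i + t i * Complex.I)))
    (f₀ := fun _ => 0) ?_ (C := 2 / (j * (α₀ / 2)) + 1) ?_
  · simp only [mul_zero, tsum_zero] at h
    refine h.congr' ?_
    filter_upwards [hx0, hα', hw.norm.eventually_lt_const hw₀] with i hi hαi hwi
    rw [logGen_sub_eq_tsum a hj hwi (by rw [hre]; exact mul_pos hi (by linarith)), ← tsum_mul_left]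
    congr 1; ext m; ring
  · intro m
    have h1 : Tendsto (fun i => regKernel a j (((m : ℂ) + 1) * (x i * α i + t i * Complex.I))) l
        (𝓝 (1 / 2 - a / j)) := by
      refine (tendsto_regKernel a hj).comp (tendsto_nhdsWithin_iff.2 ⟨?_, ?_⟩)
      · simpa using hs.const_mul ((m : ℂ) + 1)
      · filter_upwards [hx0, hα'] with i hi hαi h0
        have := natCast_add_one_mul_re_pos m (s := x i * α i + t i * Complex.I)
          (by rw [hre]; exact mul_pos hi (by linarith))
        rw [h0] at this
        simp at this
    simpa using hxc.mul h1
  · filter_upwards [hx0, hα', hx'.eventually_lt_const one_pos] with i hi hαi hxi m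
    have hαp : 0 < α i := by linarith
    rw [norm_mul, Complex.norm_real, Real.norm_of_nonneg hi.le]
    have := norm_regKernel_succ_mul_le a hj m (s := x i * α i + t i * Complex.I)
          (by rw [hre]; exact mul_pos hi hαp)
    rw [hre] at this
    calc _ ≤ x i * (2 / (j * (x i * α i)) + 1) := by gcongr
      _ = 2 / (j * α i) + x i := by field_simp
      _ ≤ _ := by gcongr

end Limits

/-! ### Behaviour at nonzero points of the arc -/

theorem hasSum_ite_dvd_one_div_sq {d : ℕ} (hd : 0 < d) :
    HasSum (fun m : ℕ => if d ∣ m + 1 then 1 / ((m : ℝ) + 1) ^ 2 else 0)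
      (1 / (d : ℝ) ^ 2 * (Real.pi ^ 2 / 6)) := by
  have hpos : ∀ m : ℕ, 1 ≤ d * (m + 1) := fun m => Nat.mul_pos hd m.succ_pos
  have hinj : Function.Injective fun m : ℕ => d * (m + 1) - 1 := by
    intro m n h
    have h' : d * (m + 1) = d * (n + 1) := by
      have := hpos m; have := hpos n; simp only at h; omega
    exact Nat.succ_injective (Nat.eq_of_mul_eq_mul_left hd h')
  refine (hinj.hasSum_iff ?_).1 ?_
  · intro m hm
    rw [if_neg]
    rintro ⟨c, hc⟩
    refine hm ⟨c - 1, ?_⟩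
    have : c ≠ 0 := by rintro rfl; simp at hc
    simp only
    rw [Nat.sub_add_cancel (Nat.one_le_iff_ne_zero.2 this), ← hc, Nat.add_sub_cancel]
  · refine (hasSum_one_div_succ_sq.mul_left (1 / (d : ℝ) ^ 2)).congr_fun fun m => ?_
    have e : ((d * (m + 1) - 1 : ℕ) : ℝ) + 1 = d * (m + 1) := by
      rw [Nat.cast_sub (hpos m)]; push_cast; ring
    simp only [Function.comp_apply]
    rw [if_pos (by rw [Nat.sub_add_cancel (hpos m)]; exact dvd_mul_right _ _), e]
    rw [mul_pow]; field_simp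

/-- Only multiples of the order $d$ of $\zeta$ survive. As $d\ge2$, the sum is at most
$r^2\frac1{d^2}\frac{\pi^2}6$, and the worst case is $d=2$. If the order is infinite the sum is
empty. -/
theorem tsum_ite_pow_eq_one_le {ζ : ℂ} (hζ : ζ ≠ 1) {r : ℝ} (hr0 : 0 ≤ r) (hr1 : r ≤ 1) :
    ∑' m : ℕ, (if ζ ^ (m + 1) = 1 then r ^ (m + 1) / ((m : ℝ) + 1) ^ 2 else 0) ≤
      Real.pi ^ 2 / 24 * r ^ 2 := by
  rcases Nat.eq_zero_or_pos (orderOf ζ) with h0 | hpos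
  · have : ∀ m : ℕ, ζ ^ (m + 1) ≠ 1 := fun m h => by
      rw [← orderOf_dvd_iff_pow_eq_one, h0] at h
      simp at h
    simp only [this, if_false, tsum_zero]
    positivity
  · have h2 : 2 ≤ orderOf ζ := by
      have : orderOf ζ ≠ 1 := fun h => hζ (orderOf_eq_one_iff.1 h)
      omega
    have hs := (hasSum_ite_dvd_one_div_sq hpos).mul_left (r ^ 2)
    have hle : ∀ m : ℕ, (if ζ ^ (m + 1) = 1 then r ^ (m + 1) / ((m : ℝ) + 1) ^ 2 else 0) ≤
        r ^ 2 * (if orderOf ζ ∣ m + 1 then 1 / ((m : ℝ) + 1) ^ 2 else 0) := by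
      intro m
      simp only [orderOf_dvd_iff_pow_eq_one]
      split_ifs with h
      · rw [mul_one_div]
        gcongr ?_ / _
        refine pow_le_pow_of_le_one hr0 hr1 ?_
        rw [← orderOf_dvd_iff_pow_eq_one] at h
        exact h2.trans (Nat.le_of_dvd m.succ_pos h)
      · simp
    refine (tsum_le_of_sum_le' (by positivity) fun s => ?_ : _ ≤ r ^ 2 *
      (1 / ((orderOf ζ : ℕ) : ℝ) ^ 2 * (Real.pi ^ 2 / 6))).trans ?_
    · refine (Finset.sum_le_sum fun m _ => hle m).trans (sum_le_hasSum s (fun m _ => ?_) hs)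
      split_ifs <;> positivity
    · have h4 : (1 : ℝ) / ((orderOf ζ : ℕ) : ℝ) ^ 2 ≤ 1 / 4 := by
        have : (2 : ℝ) ≤ (orderOf ζ : ℕ) := by exact_mod_cast h2
        exact one_div_le_one_div_of_le (by norm_num) (by nlinarith)
      nlinarith [mul_le_mul_of_nonneg_right h4 (show 0 ≤ r ^ 2 * (Real.pi ^ 2 / 6) by positivity)]

theorem tendsto_partKernel (a j : ℕ) {s : ℂ} (hs : Complex.exp (-(j * s)) ≠ 1) :
    Tendsto (partKernel a j) (𝓝 s) (𝓝 (partKernel a j s)) := by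
  have h : 1 - Complex.exp (-(j * s)) ≠ 0 := sub_ne_zero.2 hs.symm
  exact ContinuousAt.div (by fun_prop) (by fun_prop) h

section

variable {ι : Type*} {l : Filter ι} {x α t : ι → ℝ} {α₀ : ℝ} {w : ι → ℂ} {w₀ : ℂ}

/-- Put $\zeta=e^{-ijt_0}$, which is not $1$ because $0<|t_0|\le\pi/j$. The kernel at $(m+1)s$
approaches a pole exactly when $\zeta^{m+1}=1$; all other terms stay finite and are killed by the
factor $x$. -/
theorem eventually_norm_mul_logGen_le (a : ℕ) {j : ℕ} (hj : 0 < j) (hx : Tendsto x l (𝓝[>] 0))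
    (hα : Tendsto α l (𝓝 α₀)) (hα₀ : 0 < α₀) (hw : Tendsto w l (𝓝 w₀)) (hw₀ : ‖w₀‖ < 1)
    {t₀ : ℝ} (ht : Tendsto t l (𝓝 t₀)) (ht0 : t₀ ≠ 0) (htj : |t₀| ≤ Real.pi / j)
    {B : ℝ} (hB : Real.pi ^ 2 / 24 * ‖w₀‖ ^ 2 / (j * α₀) < B) :
    ∀ᶠ i in l, x i * ‖logGen a j (w i) (x i * α i + t i * Complex.I)‖ ≤ B := by
  have hx0 : ∀ᶠ i in l, 0 < x i := hx.eventually self_mem_nhdsWithin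
  have hx' : Tendsto x l (𝓝 0) := hx.mono_right nhdsWithin_le_nhds
  have hα' : ∀ᶠ i in l, α₀ / 2 < α i := hα.eventually_const_lt (by linarith)
  have hxc : Tendsto (fun i => (x i : ℂ)) l (𝓝 0) := by
    exact_mod_cast (Complex.continuous_ofReal.tendsto 0).comp hx'
  have hs : Tendsto (fun i => (x i * α i + t i * Complex.I : ℂ)) l (𝓝 (t₀ * Complex.I)) := by
    have h1 := hxc.mul ((Complex.continuous_ofReal.tendsto α₀).comp hα)
    have h2 := ((Complex.continuous_ofReal.tendsto t₀).comp ht).mul_const Complex.I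
    simpa using h1.add h2
  have hre : ∀ i, (x i * α i + t i * Complex.I : ℂ).re = x i * α i := fun i => by simp
  have hj' : (0 : ℝ) < j := by exact_mod_cast hj
  set ζ := Complex.exp (-(j * (t₀ * Complex.I))) with hζ
  have hζ1 : ζ ≠ 1 := by
    intro h
    obtain ⟨n, hn⟩ := Complex.exp_eq_one_iff.1 h
    have h1 : -(j * t₀ : ℝ) = n * (2 * Real.pi) := by
      have := congrArg Complex.im hn
      simpa using this
    have h2 : |(n : ℝ)| * (2 * Real.pi) ≤ Real.pi := by
      rw [← abs_of_pos (show 0 < 2 * Real.pi by positivity), ← abs_mul, ← h1, abs_neg, abs_mul,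
        abs_of_pos hj', mul_comm]
      exact (le_div_iff₀ hj').1 htj
    have h3 : |n| < 1 := by
      have : |(n : ℝ)| < 1 := by nlinarith [Real.pi_pos]
      exact_mod_cast this
    rw [Int.abs_lt_one_iff] at h3
    rw [h3] at h1
    have : (j : ℝ) * t₀ = 0 := by simpa using h1
    rcases mul_eq_zero.1 this with h | h
    · exact hj'.ne' h
    · exact ht0 h
  have hζm : ∀ m : ℕ, Complex.exp (-(j * (((m : ℂ) + 1) * (t₀ * Complex.I)))) = ζ ^ (m + 1) := by
    intro m
    rw [hζ, ← Complex.exp_nat_mul]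
    congr 1; push_cast; ring
  obtain ⟨r, hr, hr1⟩ := exists_between hw₀
  have hr0 := (norm_nonneg w₀).trans hr.le
  -- The majorant uses the crude kernel bound on the polar terms, where an actual limit need not
  -- exist, and the exact modulus on the others.
  set g : ι → ℕ → ℝ := fun i m => if ζ ^ (m + 1) = 1 then
    ‖w i‖ ^ (m + 1) / ((m : ℝ) + 1) * (1 / (j * (((m : ℝ) + 1) * α i)) + x i) else
    ‖w i‖ ^ (m + 1) / ((m : ℝ) + 1) *
      ‖x i * partKernel a j (((m : ℂ) + 1) * (x i * α i + t i * Complex.I))‖ with hg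
  have hpk : ∀ᶠ i in l, 0 < x i ∧ 0 < α i ∧ ∀ m : ℕ,
      ‖x i * partKernel a j (((m : ℂ) + 1) * (x i * α i + t i * Complex.I))‖ ≤
        1 / (j * (((m : ℝ) + 1) * α i)) + x i := by
    filter_upwards [hx0, hα'] with i hi hαi
    have hαp : 0 < α i := by linarith
    refine ⟨hi, hαp, fun m => ?_⟩
    rw [norm_mul, Complex.norm_real, Real.norm_of_nonneg hi.le]
    have := norm_partKernel_le a hj (natCast_add_one_mul_re_pos m
      (s := x i * α i + t i * Complex.I) (by rw [hre]; exact mul_pos hi hαp))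
    rw [natCast_add_one_mul_re, hre] at this
    calc _ ≤ x i * (1 / (j * (((m : ℝ) + 1) * (x i * α i))) + 1) := by gcongr
      _ = _ := by field_simp
  have hglim : Tendsto (fun i => ∑' m, g i m) l (𝓝 (∑' m : ℕ,
      (if ζ ^ (m + 1) = 1 then ‖w₀‖ ^ (m + 1) / ((m : ℝ) + 1) ^ 2 else 0) / (j * α₀))) := by
    refine tendsto_tsum_of_dominated_convergence
      (bound := fun m => r ^ (m + 1) * (1 / (j * (α₀ / 2)) + 1))
      ((summable_pow_succ hr0 hr1).mul_right _) (fun m => ?_) ?_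
    · by_cases hm : ζ ^ (m + 1) = 1
      · simp only [hg, if_pos hm]
        have h1 := (hw.norm.pow (m + 1)).div_const ((m : ℝ) + 1)
        have h2 : Tendsto (fun i => 1 / (j * (((m : ℝ) + 1) * α i)) + x i) l
            (𝓝 (1 / (j * (((m : ℝ) + 1) * α₀)) + 0)) :=
          (tendsto_const_nhds.div ((hα.const_mul _).const_mul _) (by positivity)).add hx'
        have h3 := h1.mul h2
        convert h3 using 2
        field_simp
        simp
      · simp only [hg, if_neg hm]
        have h1 : Tendsto (fun i =>
            partKernel a j (((m : ℂ) + 1) * (x i * α i + t i * Complex.I))) l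
            (𝓝 (partKernel a j (((m : ℂ) + 1) * (t₀ * Complex.I)))) :=
          (tendsto_partKernel a j (by rwa [hζm])).comp (hs.const_mul _)
        have h2 := ((hw.norm.pow (m + 1)).div_const ((m : ℝ) + 1)).mul (hxc.mul h1).norm
        simpa using h2
    · filter_upwards [hpk, hα', hw.norm.eventually_lt_const hr, hx'.eventually_lt_const one_pos] with
        i ⟨hxi, hαi, hi⟩ hα2 hir hx1 m
      have hb : 1 / (j * (((m : ℝ) + 1) * α i)) + x i ≤ 1 / (j * (α₀ / 2)) + 1 := by
        gcongr
        exact hα2.le.trans (le_mul_of_one_le_left hαi.le (by simp))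
      have hwm : ‖w i‖ ^ (m + 1) / ((m : ℝ) + 1) ≤ r ^ (m + 1) := by
        refine (div_le_self (by positivity) (by simp)).trans ?_
        gcongr
      have hb0 : 0 ≤ 1 / (j * (((m : ℝ) + 1) * α i)) + x i := by positivity
      simp only [hg]
      split_ifs
      · rw [Real.norm_of_nonneg (by positivity)]
        gcongr
      · rw [Real.norm_of_nonneg (by positivity)]
        exact mul_le_mul hwm ((hi m).trans hb) (norm_nonneg _) (by positivity)
  have hlt : (∑' m : ℕ,
      (if ζ ^ (m + 1) = 1 then ‖w₀‖ ^ (m + 1) / ((m : ℝ) + 1) ^ 2 else 0) / (j * α₀)) < B := by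
    rw [tsum_div_const]
    refine lt_of_le_of_lt ?_ hB
    have := tsum_ite_pow_eq_one_le hζ1 (norm_nonneg w₀) hw₀.le
    gcongr
  filter_upwards [hglim.eventually_lt_const hlt, hpk, hw.norm.eventually_lt_const hw₀] with
    i hi ⟨hxi, hαi, hpki⟩ hwi
  refine le_trans ?_ hi.le
  have e : x i * ‖logGen a j (w i) (x i * α i + t i * Complex.I)‖ =
      ‖(x i : ℂ) * logGen a j (w i) (x i * α i + t i * Complex.I)‖ := by
    rw [norm_mul, Complex.norm_real, Real.norm_of_nonneg hxi.le]
  rw [e, logGen, ← tsum_mul_left]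
  have hnm : ∀ m : ℕ, ‖w i ^ (m + 1) / ((m : ℂ) + 1)‖ = ‖w i‖ ^ (m + 1) / ((m : ℝ) + 1) := fun m => by
    rw [norm_div, norm_pow, norm_natCast_add_one]
  have hsum : Summable (g i) := by
    refine .of_nonneg_of_le (f := fun m => ‖w i‖ ^ (m + 1) * (1 / (j * α i) + x i))
      (fun m => ?_) (fun m => ?_) ((summable_pow_succ (norm_nonneg _) hwi).mul_right _)
    · simp only [hg]
      split_ifs <;> positivity
    · have h1 : ‖w i‖ ^ (m + 1) / ((m : ℝ) + 1) ≤ ‖w i‖ ^ (m + 1) :=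
        div_le_self (by positivity) (by simp)
      have hb : 1 / (j * (((m : ℝ) + 1) * α i)) + x i ≤ 1 / (j * α i) + x i := by
        gcongr
        exact le_mul_of_one_le_left hαi.le (by simp)
      simp only [hg]
      split_ifs
      · gcongr
      · exact mul_le_mul h1 ((hpki m).trans hb) (norm_nonneg _) (by positivity)
  refine tsum_of_norm_bounded hsum.hasSum fun m => ?_
  rw [mul_left_comm, norm_mul, hnm]
  simp only [hg]
  split_ifs
  · exact mul_le_mul_of_nonneg_left (hpki m) (by positivity)
  · exact le_rfl

end

/-! ### The generating function and Cauchy's formula -/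

open scoped PowerSeries.WithPiTopology in
theorem hasProd_weightedPartitionCount (a j : ℕ) (z : ℂ) :
    HasProd (fun i => if i + 1 ≡ a [MOD j] then
      PowerSeries.mk (fun m => if i + 1 ∣ m then z ^ (m / (i + 1)) else 0) else 1)
      (PowerSeries.mk fun n => weightedPartitionCount a j n z) := by
  have h := Nat.Partition.hasProd_genFun fun i c => if i ≡ a [MOD j] then z ^ c else 0
  convert! h using 1
  · ext1 i
    split_ifs with hi
    · ext m
      rw [map_add, (Nat.Partition.summable_genFun_term' (R := ℂ) (fun _ c => z ^ c)
        i.succ_ne_zero).map_tsum _ (PowerSeries.WithPiTopology.continuous_coeff _ _)]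
      simp only [PowerSeries.coeff_mk, PowerSeries.coeff_one, map_smul, PowerSeries.coeff_X_pow,
        smul_eq_mul, mul_ite, mul_one, mul_zero]
      by_cases hm : i + 1 ∣ m
      · obtain ⟨k, rfl⟩ := hm
        rw [if_pos (dvd_mul_right _ _), Nat.mul_div_cancel_left _ i.succ_pos]
        rcases k with _ | k
        · simp
        · rw [tsum_eq_single k]
          · simp
          · intro b hb
            rw [if_neg]
            intro h
            have := Nat.eq_of_mul_eq_mul_left i.succ_pos h
            omega
      · rw [if_neg hm, if_neg (by rintro rfl; simp at hm)]
        have : ∀ b, m ≠ (i + 1) * (b + 1) := fun b hb => hm ⟨_, hb⟩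
        simp [this]
    · simp
  · ext n
    rw [Nat.Partition.coeff_genFun, PowerSeries.coeff_mk, weightedPartitionCount, Finset.sum_filter]
    refine Finset.sum_congr rfl fun p _ => ?_
    rw [Finsupp.prod, Finset.prod_ite_zero]
    simp only [Multiset.toFinsupp_support, Multiset.mem_toFinset, Multiset.toFinsupp_apply]
    split_ifs with hp
    · rw [Finset.prod_pow_eq_pow_sum, Multiset.toFinset_sum_count_eq]
    · rfl

/-- The power series `p` converges absolutely at `q`, with sum `v`. -/
def PowerSeries.AbsSum (p : PowerSeries ℂ) (q v : ℂ) : Prop :=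
  (Summable fun m => ‖PowerSeries.coeff m p * q ^ m‖) ∧
    HasSum (fun m => PowerSeries.coeff m p * q ^ m) v

theorem PowerSeries.AbsSum.one (q : ℂ) : PowerSeries.AbsSum 1 q 1 := by
  have h : ∀ m : ℕ, PowerSeries.coeff m (1 : PowerSeries ℂ) * q ^ m = if m = 0 then 1 else 0 := by
    intro m
    rw [PowerSeries.coeff_one]
    split_ifs with hm <;> simp [hm]
  simp only [PowerSeries.AbsSum, h]
  refine ⟨?_, hasSum_ite_eq 0 1⟩
  exact (hasSum_ite_eq (0 : ℕ) (1 : ℂ)).summable.norm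

theorem PowerSeries.AbsSum.mul {p p' : PowerSeries ℂ} {q v v' : ℂ} (h : p.AbsSum q v)
    (h' : p'.AbsSum q v') : (p * p').AbsSum q (v * v') := by
  have e : ∀ n, PowerSeries.coeff n (p * p') * q ^ n = ∑ kl ∈ Finset.HasAntidiagonal.antidiagonal n,
      (PowerSeries.coeff kl.1 p * q ^ kl.1) * (PowerSeries.coeff kl.2 p' * q ^ kl.2) := by
    intro n
    rw [PowerSeries.coeff_mul, Finset.sum_mul]
    refine Finset.sum_congr rfl fun kl hkl => ?_
    rw [← Finset.HasAntidiagonal.mem_antidiagonal.1 hkl, pow_add]; ring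
  have hs := summable_norm_sum_mul_antidiagonal_of_summable_norm h.1 h'.1
  have ht := tsum_mul_tsum_eq_tsum_sum_antidiagonal_of_summable_norm h.1 h'.1
  simp only [PowerSeries.AbsSum, e]
  refine ⟨hs, ?_⟩
  rw [h.2.tsum_eq, h'.2.tsum_eq] at ht
  rw [ht]
  exact hs.of_norm.hasSum

theorem PowerSeries.AbsSum.prod {p : ℕ → PowerSeries ℂ} {q : ℂ} {v : ℕ → ℂ}
    (h : ∀ i, (p i).AbsSum q (v i)) (s : Finset ℕ) :
    (∏ i ∈ s, p i).AbsSum q (∏ i ∈ s, v i) := by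
  induction s using Finset.cons_induction with
  | empty => exact PowerSeries.AbsSum.one q
  | cons i s hi ih =>
    rw [Finset.prod_cons, Finset.prod_cons]
    exact (h i).mul ih

theorem PowerSeries.absSum_mk_dvd (i : ℕ) {z q : ℂ} (h : ‖z * q ^ (i + 1)‖ < 1) :
    (PowerSeries.mk (fun m => if i + 1 ∣ m then z ^ (m / (i + 1)) else 0)).AbsSum q
      (1 - z * q ^ (i + 1))⁻¹ := by
  have hinj : Function.Injective fun c : ℕ => (i + 1) * c := fun _ _ h =>
    Nat.eq_of_mul_eq_mul_left i.succ_pos h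
  have hout : ∀ m ∉ Set.range (fun c : ℕ => (i + 1) * c),
      (if i + 1 ∣ m then z ^ (m / (i + 1)) else 0) * q ^ m = 0 := by
    intro m hm
    rw [if_neg, zero_mul]
    rintro ⟨c, rfl⟩
    exact hm ⟨c, rfl⟩
  have hcomp : ((fun m => (if i + 1 ∣ m then z ^ (m / (i + 1)) else 0) * q ^ m) ∘
      fun c : ℕ => (i + 1) * c) = fun c => (z * q ^ (i + 1)) ^ c := by
    ext c
    simp only [Function.comp_apply]
    rw [if_pos (dvd_mul_right _ _), Nat.mul_div_cancel_left _ i.succ_pos, mul_pow, pow_mul]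
  simp only [PowerSeries.AbsSum, PowerSeries.coeff_mk]
  constructor
  · rw [← hinj.summable_iff]
    · have := (summable_geometric_of_norm_lt_one h).norm
      exact this.congr fun c => by rw [← congrFun hcomp c]; rfl
    · intro m hm
      rw [hout m hm, norm_zero]
  · rw [← hinj.hasSum_iff hout, hcomp]
    exact hasSum_geometric_of_norm_lt_one h

theorem integral_exp_neg_int_mul (σ : ℝ) (k : ℤ) :
    ∫ t in (-Real.pi)..Real.pi, Complex.exp (k * (σ + t * Complex.I)) =
      if k = 0 then 2 * Real.pi else 0 := by
  split_ifs with hk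
  · simp [hk]; ring
  · have hc : (k : ℂ) * Complex.I ≠ 0 := by simp [hk]
    have e : ∀ t : ℝ, Complex.exp (k * (σ + t * Complex.I)) =
        Complex.exp (k * σ) * Complex.exp (k * Complex.I * t) := fun t => by
      rw [← Complex.exp_add]; congr 1; ring
    simp only [e]
    rw [intervalIntegral.integral_const_mul, integral_exp_mul_complex hc]
    have : Complex.exp (k * Complex.I * (Real.pi : ℝ)) =
        Complex.exp (k * Complex.I * ((-Real.pi : ℝ) : ℂ)) := by
      rw [Complex.exp_eq_exp_iff_exists_int]
      exact ⟨k, by push_cast; ring⟩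
    rw [this]; simp

theorem integral_absSum {p : PowerSeries ℂ} {σ : ℝ} {v : ℝ → ℂ}
    (h : ∀ t : ℝ, p.AbsSum (Complex.exp (-(σ + t * Complex.I))) (v t)) (n : ℕ) :
    ∫ t in (-Real.pi)..Real.pi, v t * Complex.exp (n * (σ + t * Complex.I)) =
      PowerSeries.coeff n p * (2 * Real.pi) := by
  have hn : ∀ t : ℝ, ‖Complex.exp (-(σ + t * Complex.I))‖ = Real.exp (-σ) := fun t => by
    rw [Complex.norm_exp]; simp
  have hn2 : ∀ t : ℝ, ‖Complex.exp (n * (σ + t * Complex.I))‖ = Real.exp (n * σ) := fun t => by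
    rw [Complex.norm_exp]; simp
  have hs : Summable fun m => ‖PowerSeries.coeff m p‖ * Real.exp (-σ) ^ m := by
    have := (h 0).1
    simpa only [norm_mul, norm_pow, hn] using this
  have key := intervalIntegral.hasSum_integral_of_dominated_convergence (a := -Real.pi)
    (b := Real.pi) (μ := MeasureTheory.volume)
    (F := fun m t => PowerSeries.coeff m p * Complex.exp (-(σ + t * Complex.I)) ^ m *
      Complex.exp (n * (σ + t * Complex.I)))
    (f := fun t => v t * Complex.exp (n * (σ + t * Complex.I)))
    (fun m _ => ‖PowerSeries.coeff m p‖ * Real.exp (-σ) ^ m * Real.exp (n * σ))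
    (fun m => Continuous.aestronglyMeasurable (by fun_prop))
    (fun m => Eventually.of_forall fun t _ => by
      rw [norm_mul, norm_mul, norm_pow, hn, hn2])
    (Eventually.of_forall fun t _ => hs.mul_right _)
    intervalIntegrable_const
    (Eventually.of_forall fun t _ => (h t).2.mul_right _)
  refine key.unique ?_
  have e : ∀ m : ℕ, ∫ t in (-Real.pi)..Real.pi,
      PowerSeries.coeff m p * Complex.exp (-(σ + t * Complex.I)) ^ m *
      Complex.exp (n * (σ + t * Complex.I)) =
      if m = n then PowerSeries.coeff n p * (2 * Real.pi) else 0 := by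
    intro m
    have e2 : ∀ t : ℝ, PowerSeries.coeff m p * Complex.exp (-(σ + t * Complex.I)) ^ m *
        Complex.exp (n * (σ + t * Complex.I)) =
        PowerSeries.coeff m p * Complex.exp (((n - m : ℤ) : ℂ) * (σ + t * Complex.I)) := by
      intro t
      rw [← Complex.exp_nat_mul, mul_assoc, ← Complex.exp_add]
      congr 2; push_cast; ring
    simp only [e2]
    rw [intervalIntegral.integral_const_mul, integral_exp_neg_int_mul]
    by_cases hm : m = n
    · simp [hm]
    · rw [if_neg (by omega), if_neg hm, Complex.ofReal_zero, mul_zero]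
  simp only [e]
  exact hasSum_ite_eq n _

theorem hasSum_ite_modEq_exp {a j : ℕ} (ha : 0 < a) (haj : a < j) {s : ℂ} (hs : 0 < s.re) :
    HasSum (fun i : ℕ => if i + 1 ≡ a [MOD j] then Complex.exp (-s) ^ (i + 1) else 0)
      (partKernel a j s) := by
  have hj : 0 < j := ha.trans haj
  have hinj : Function.Injective fun m : ℕ => a + j * m - 1 := by
    intro m n h
    refine Nat.eq_of_mul_eq_mul_left hj ?_
    simp only at h
    omega
  refine (hinj.hasSum_iff ?_).1 ?_
  · intro i hi
    rw [if_neg]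
    intro h
    refine hi ⟨(i + 1) / j, ?_⟩
    have h1 : (i + 1) % j = a := by
      rw [h, Nat.mod_eq_of_lt haj]
    have h2 := Nat.mod_add_div (i + 1) j
    simp only
    rw [h1] at h2
    omega
  · have e : ((fun i : ℕ => if i + 1 ≡ a [MOD j] then Complex.exp (-s) ^ (i + 1) else 0) ∘
        fun m : ℕ => a + j * m - 1) =
        fun m => Complex.exp (-(a * s)) * Complex.exp (-(j * s)) ^ m := by
      ext m
      have h1 : a + j * m - 1 + 1 = a + j * m := by omega
      simp only [Function.comp_apply]
      rw [h1, if_pos (by simp [Nat.ModEq]), ← Complex.exp_nat_mul, ← Complex.exp_nat_mul,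
        ← Complex.exp_add]
      congr 1; push_cast; ring
    rw [e, partKernel, div_eq_mul_inv]
    exact (hasSum_geometric_of_norm_lt_one (norm_exp_neg_natCast_mul_lt_one hj hs)).mul_left _

/-- An absolutely convergent double series summed both ways: rows are logarithms of the Euler
factors, columns are terms of `logGen`. The norm bound, which depends on $s$ only through
$\mathrm{Re}\,s$, dominates the partial products in Cauchy's formula. -/
theorem hasSum_ite_modEq_neg_log {a j : ℕ} (ha : 0 < a) (haj : a < j) {z s : ℂ} (hz : ‖z‖ < 1)
    (hs : 0 < s.re) :
    (∀ i : ℕ, ‖if i + 1 ≡ a [MOD j] then -Complex.log (1 - z * Complex.exp (-s) ^ (i + 1)) else 0‖ ≤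
      Real.exp (-s.re) ^ (i + 1) * ∑' m : ℕ, ‖z‖ ^ (m + 1)) ∧
    HasSum (fun i : ℕ => if i + 1 ≡ a [MOD j] then
      -Complex.log (1 - z * Complex.exp (-s) ^ (i + 1)) else 0) (logGen a j z s) := by
  have hq : ‖Complex.exp (-s)‖ = Real.exp (-s.re) := by rw [Complex.norm_exp]; simp
  have hρ0 := Real.exp_pos (-s.re)
  have hρ1 : Real.exp (-s.re) < 1 := by rw [Real.exp_lt_one_iff]; linarith
  set ρ := Real.exp (-s.re) with hρ
  have hsz := summable_pow_succ (norm_nonneg z) hz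
  have hsρ := summable_pow_succ hρ0.le hρ1
  set F : ℕ → ℕ → ℂ := fun i m => if i + 1 ≡ a [MOD j] then
    (z * Complex.exp (-s) ^ (i + 1)) ^ (m + 1) / ((m : ℂ) + 1) else 0 with hF
  have hFle : ∀ i m, ‖F i m‖ ≤ ρ ^ (i + 1) * ‖z‖ ^ (m + 1) := by
    intro i m
    simp only [hF]
    split_ifs
    · refine (norm_pow_succ_div_le _ m).trans ?_
      rw [norm_mul, norm_pow, hq, mul_pow, mul_comm]
      gcongr
      exact pow_le_of_le_one (by positivity) (pow_le_one₀ hρ0.le hρ1.le) m.succ_ne_zero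
    · rw [norm_zero]; positivity
  have hFs : Summable (Function.uncurry F) := by
    refine .of_norm_bounded (g := fun p : ℕ × ℕ => ρ ^ (p.1 + 1) * ‖z‖ ^ (p.2 + 1))
      (hsρ.mul_of_nonneg hsz (fun _ => by positivity) fun _ => by positivity) fun p => hFle p.1 p.2
  have hrow : ∀ i, ∑' m, F i m = if i + 1 ≡ a [MOD j] then
      -Complex.log (1 - z * Complex.exp (-s) ^ (i + 1)) else 0 := by
    intro i
    simp only [hF]
    split_ifs
    · refine (Complex.hasSum_taylorSeries_neg_log' ?_).tsum_eq
      rw [norm_mul, norm_pow, hq]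
      exact mul_lt_one_of_nonneg_of_lt_one_left (norm_nonneg z) hz (pow_le_one₀ hρ0.le hρ1.le)
    · exact tsum_zero
  have hcol : ∀ m, ∑' i, F i m =
      z ^ (m + 1) / ((m : ℂ) + 1) * partKernel a j (((m : ℂ) + 1) * s) := by
    intro m
    rw [← (hasSum_ite_modEq_exp ha haj (natCast_add_one_mul_re_pos m hs)).tsum_eq, ← tsum_mul_left]
    congr 1; ext i
    simp only [hF]
    split_ifs
    · rw [← mul_neg, show ((m : ℂ) + 1) = ((m + 1 : ℕ) : ℂ) by push_cast; rfl, Complex.exp_nat_mul]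
      rw [mul_pow, ← pow_mul, ← pow_mul, mul_comm (i + 1)]
      ring
    · rw [mul_zero]
  refine ⟨fun i => ?_, ?_⟩
  · rw [← hrow, ← tsum_mul_left]
    exact tsum_of_norm_bounded (hsz.mul_left _).hasSum (hFle i)
  · have h1 : HasSum (fun i => ∑' m, F i m) (∑' i, ∑' m, F i m) := hFs.prod.hasSum
    rw [← hFs.tsum_comm] at h1
    simp only [hrow, hcol] at h1
    exact h1

theorem continuous_logGen_line (a : ℕ) {j : ℕ} (hj : 0 < j) {z : ℂ} (hz : ‖z‖ < 1) {σ : ℝ}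
    (hσ : 0 < σ) : Continuous fun t : ℝ => logGen a j z (σ + t * Complex.I) := by
  have hre : ∀ t : ℝ, (σ + t * Complex.I : ℂ).re = σ := fun t => by simp
  refine continuous_tsum (u := fun m => ‖z‖ ^ (m + 1) * (1 / (j * σ) + 1)) (fun m => ?_)
    ((summable_pow_succ (norm_nonneg z) hz).mul_right _) fun m t => ?_
  · refine continuous_const.mul (Continuous.div (by fun_prop) (by fun_prop) fun t => ?_)
    refine one_sub_ne_zero_of_norm_lt_one (norm_exp_neg_natCast_mul_lt_one hj ?_)
    exact natCast_add_one_mul_re_pos m (by rwa [hre])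
  · rw [norm_mul]
    have := norm_partKernel_succ_mul_le a hj m (s := σ + t * Complex.I) (by rwa [hre])
    rw [hre] at this
    exact mul_le_mul (norm_pow_succ_div_le z m) this (norm_nonneg _) (by positivity)

open scoped PowerSeries.WithPiTopology in
/-- Cauchy's formula for the weighted partition counts. -/
theorem weightedPartitionCount_mul_two_pi {a j : ℕ} (ha : 0 < a) (haj : a < j) (n : ℕ) {z : ℂ}
    (hz : ‖z‖ < 1) {σ : ℝ} (hσ : 0 < σ) :
    weightedPartitionCount a j n z * (2 * Real.pi) =
      ∫ t in (-Real.pi)..Real.pi, Complex.exp (logGen a j z (σ + t * Complex.I)) *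
        Complex.exp (n * (σ + t * Complex.I)) := by
  have hre : ∀ t : ℝ, (σ + t * Complex.I : ℂ).re = σ := fun t => by simp
  set P : ℕ → PowerSeries ℂ := fun i => if i + 1 ≡ a [MOD j] then
      PowerSeries.mk (fun m => if i + 1 ∣ m then z ^ (m / (i + 1)) else 0) else 1 with hP
  set ev : ℝ → ℕ → ℂ := fun t i => if i + 1 ≡ a [MOD j] then
    -Complex.log (1 - z * Complex.exp (-(σ + t * Complex.I)) ^ (i + 1)) else 0 with hev
  have hqn : ∀ t : ℝ, ∀ i : ℕ, ‖z * Complex.exp (-(σ + t * Complex.I)) ^ (i + 1)‖ < 1 := by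
    intro t i
    rw [norm_mul, norm_pow, Complex.norm_exp, Complex.neg_re, hre]
    refine mul_lt_one_of_nonneg_of_lt_one_left (norm_nonneg z) hz (pow_le_one₀ (by positivity) ?_)
    rw [Real.exp_le_one_iff]; linarith
  have hPabs : ∀ t : ℝ, ∀ i, (P i).AbsSum (Complex.exp (-(σ + t * Complex.I)))
      (Complex.exp (ev t i)) := by
    intro t i
    simp only [hP, hev]
    split_ifs
    · rw [Complex.exp_neg (Complex.log _), Complex.exp_log (one_sub_ne_zero_of_norm_lt_one (hqn t i))]
      exact PowerSeries.absSum_mk_dvd i (hqn t i)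
    · rw [Complex.exp_zero]
      exact PowerSeries.AbsSum.one _
  have hprod : ∀ t : ℝ, ∀ N, (∏ i ∈ Finset.range N, P i).AbsSum (Complex.exp (-(σ + t * Complex.I)))
      (Complex.exp (∑ i ∈ Finset.range N, ev t i)) := by
    intro t N
    rw [Complex.exp_sum]
    exact PowerSeries.AbsSum.prod (hPabs t) _
  -- Cauchy's formula is applied to the finite products only. The limit in `N` is taken
  -- coefficientwise on one side and by dominated convergence on the other, so the infinite product
  -- is never evaluated as a power series.
  have hcoeff : Tendsto (fun N => PowerSeries.coeff n (∏ i ∈ Finset.range N, P i)) atTop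
      (𝓝 (weightedPartitionCount a j n z)) := by
    have h1 := (hasProd_weightedPartitionCount a j z).tendsto_prod_nat
    have h2 := ((PowerSeries.WithPiTopology.continuous_coeff ℂ n).tendsto _).comp h1
    rw [PowerSeries.coeff_mk] at h2
    exact h2
  have hlog := fun t : ℝ => hasSum_ite_modEq_neg_log ha haj (s := σ + t * Complex.I) hz
    (by rwa [hre])
  have hsρ := summable_pow_succ (Real.exp_pos (-σ)).le (by rw [Real.exp_lt_one_iff]; linarith)
  have hbound : ∀ (t : ℝ) N, ‖∑ i ∈ Finset.range N, ev t i‖ ≤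
      (∑' i : ℕ, Real.exp (-σ) ^ (i + 1)) * ∑' m : ℕ, ‖z‖ ^ (m + 1) := by
    intro t N
    have h0 : 0 ≤ ∑' m : ℕ, ‖z‖ ^ (m + 1) := tsum_nonneg fun _ => by positivity
    refine (norm_sum_le_of_le _ fun i _ => (hlog t).1 i).trans ?_
    rw [← Finset.sum_mul, hre]
    gcongr
    exact hsρ.sum_le_tsum _ fun _ _ => by positivity
  have hlim := intervalIntegral.tendsto_integral_filter_of_dominated_convergence
    (a := -Real.pi) (b := Real.pi) (μ := MeasureTheory.volume) (l := atTop)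
    (F := fun N (t : ℝ) => Complex.exp (∑ i ∈ Finset.range N, ev t i) *
      Complex.exp (n * (σ + t * Complex.I)))
    (f := fun t => Complex.exp (logGen a j z (σ + t * Complex.I)) *
      Complex.exp (n * (σ + t * Complex.I)))
    (fun _ => Real.exp ((∑' i : ℕ, Real.exp (-σ) ^ (i + 1)) * ∑' m : ℕ, ‖z‖ ^ (m + 1)) *
      Real.exp (n * σ)) (Eventually.of_forall fun N => ?_)
    (Eventually.of_forall fun N => Eventually.of_forall fun t _ => ?_) intervalIntegrable_const
    (Eventually.of_forall fun t _ => ?_)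
  · simp only [fun N => integral_absSum (fun t => hprod t N) n] at hlim
    exact tendsto_nhds_unique (hcoeff.mul_const _) hlim
  · refine Continuous.aestronglyMeasurable (Continuous.mul (Complex.continuous_exp.comp
      (continuous_finsetSum _ fun i _ => ?_)) (by fun_prop))
    simp only [hev]
    split_ifs
    · refine (Continuous.clog (by fun_prop) fun t => one_sub_mem_slitPlane (hqn t i)).neg
    · exact continuous_const
  · rw [norm_mul, Complex.norm_exp, Complex.norm_exp]
    gcongr
    · exact (Complex.re_le_norm _).trans (hbound t N)
    · simp
  · exact ((Complex.continuous_exp.tendsto _).comp (hlog t).2.tendsto_sum_nat).mul_const _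

/-- The denominators $1-e^{-j(m+1)s}$ do not see the shift, while the numerators gain the $(m+1)$-st
power of a fixed root of unity, which $z^{m+1}$ absorbs. -/
theorem logGen_add_rotation (a : ℕ) {j : ℕ} (hj : 0 < j) (z s : ℂ) (k : ℕ) :
    logGen a j z (s + 2 * Real.pi * Complex.I * k / j) =
      logGen a j (z * Complex.exp (-(2 * Real.pi * Complex.I * k * a / j))) s := by
  have hj' : (j : ℂ) ≠ 0 := by exact_mod_cast hj.ne'
  rw [logGen, logGen]
  congr 1; ext m
  have h1 : Complex.exp (-(j * (((m : ℂ) + 1) * (s + 2 * Real.pi * Complex.I * k / j)))) =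
      Complex.exp (-(j * (((m : ℂ) + 1) * s))) := by
    rw [Complex.exp_eq_exp_iff_exists_int]
    refine ⟨-((m + 1) * k), ?_⟩
    push_cast
    field_simp
    ring
  have h2 : Complex.exp (-(a * (((m : ℂ) + 1) * (s + 2 * Real.pi * Complex.I * k / j)))) =
      Complex.exp (-(2 * Real.pi * Complex.I * k * a / j)) ^ (m + 1) *
        Complex.exp (-(a * (((m : ℂ) + 1) * s))) := by
    rw [← Complex.exp_nat_mul, ← Complex.exp_add]
    congr 1
    push_cast
    field_simp
    ring
  rw [partKernel, partKernel, h1, h2, mul_pow]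
  ring

theorem weightedPartitionCount_mul_two_pi_eq_sum {a j : ℕ} (ha : 0 < a) (haj : a < j) (n : ℕ)
    {z : ℂ} (hz : ‖z‖ < 1) {σ : ℝ} (hσ : 0 < σ) :
    weightedPartitionCount a j n z * (2 * Real.pi) =
      ∑ k ∈ Finset.range j, Complex.exp (2 * Real.pi * Complex.I * k * n / j) *
        ∫ t in (-(Real.pi / j))..(Real.pi / j),
          Complex.exp (logGen a j (z * Complex.exp (-(2 * Real.pi * Complex.I * k * a / j)))
            (σ + t * Complex.I)) * Complex.exp (n * (σ + t * Complex.I)) := by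
  have hj : 0 < j := ha.trans haj
  have hj' : (j : ℂ) ≠ 0 := by exact_mod_cast hj.ne'
  have hjr : (j : ℝ) ≠ 0 := by exact_mod_cast hj.ne'
  rw [weightedPartitionCount_mul_two_pi ha haj n hz hσ]
  set f : ℝ → ℂ := fun t => Complex.exp (logGen a j z (σ + t * Complex.I)) *
        Complex.exp (n * (σ + t * Complex.I)) with hf
  have hfc : Continuous f := (Complex.continuous_exp.comp (continuous_logGen_line a hj hz hσ)).mul
    (by fun_prop)
  have hshift : ∀ (t : ℝ) (k : ℕ), f (t + 2 * Real.pi * k / j) =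
      Complex.exp (2 * Real.pi * Complex.I * k * n / j) *
        (Complex.exp (logGen a j (z * Complex.exp (-(2 * Real.pi * Complex.I * k * a / j)))
            (σ + t * Complex.I)) * Complex.exp (n * (σ + t * Complex.I))) := by
    intro t k
    have e1 : (σ : ℂ) + ((t + 2 * Real.pi * k / j : ℝ) : ℂ) * Complex.I =
        (σ + t * Complex.I) + 2 * Real.pi * Complex.I * k / j := by push_cast; ring
    simp only [hf]
    rw [e1, logGen_add_rotation a hj, mul_add, Complex.exp_add]
    rw [show (n : ℂ) * (2 * Real.pi * Complex.I * k / j) = 2 * Real.pi * Complex.I * k * n / j by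
      ring]
    ring
  have hper : Function.Periodic f (2 * Real.pi) := by
    intro t
    have h := hshift t j
    rw [mul_div_assoc, div_self hjr, mul_one] at h
    rw [h]
    have e1 : Complex.exp (2 * Real.pi * Complex.I * j * n / j) = 1 := by
      rw [Complex.exp_eq_one_iff]
      exact ⟨n, by push_cast; field_simp⟩
    have e2 : Complex.exp (-(2 * Real.pi * Complex.I * j * a / j)) = 1 := by
      rw [Complex.exp_eq_one_iff]
      exact ⟨-a, by push_cast; field_simp⟩
    rw [e1, e2, mul_one, one_mul]
  -- Starting the period at $-\pi/j$ centres the pieces at the points $2\pi k/j$.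
  have h1 := hper.intervalIntegral_add_eq (-Real.pi) (-(Real.pi / j))
  rw [show -Real.pi + 2 * Real.pi = Real.pi by ring] at h1
  rw [h1]
  have h2 := intervalIntegral.sum_integral_adjacent_intervals (f := f) (μ := MeasureTheory.volume)
    (a := fun k : ℕ => -(Real.pi / j) + 2 * Real.pi * k / j) (n := j)
    fun k _ => hfc.intervalIntegrable _ _
  simp only [Nat.cast_zero, mul_zero, zero_div, add_zero] at h2
  rw [mul_div_assoc (2 * Real.pi), div_self hjr, mul_one] at h2
  rw [← h2]
  refine Finset.sum_congr rfl fun k _ => ?_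
  rw [← intervalIntegral.integral_const_mul]
  simp only [← hshift]
  rw [intervalIntegral.integral_comp_add_right (fun t => f t)]
  congr 1
  push_cast
  field_simp
  ring

theorem norm_logGen_sub_le {a j : ℕ} (hj : 0 < j) {K C : ℝ}
    (hC : ∀ s : ℂ, 0 < s.re → |s.im| ≤ K * s.re → ‖regKernel a j s‖ ≤ C) {r : ℝ} (hr : r < 1)
    {w s : ℂ} (hw : ‖w‖ ≤ r) (hs : 0 < s.re) (hsK : |s.im| ≤ K * s.re) :
    ‖logGen a j w s - dilog w / (j * s)‖ ≤ (∑' m : ℕ, r ^ (m + 1)) * C := by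
  rw [logGen_sub_eq_tsum a hj (hw.trans_lt hr) hs]
  refine norm_tsum_pow_succ_div_mul_le (fun m => hC _ (natCast_add_one_mul_re_pos m hs) ?_) hw hr
  rw [natCast_add_one_mul_im, natCast_add_one_mul_re, abs_mul, abs_of_pos (by positivity)]
  nlinarith [mul_le_mul_of_nonneg_left hsK (show (0 : ℝ) ≤ (m : ℝ) + 1 by positivity)]

/-! ### The major arc -/

/-- Completing the square: $\frac{A^2}s+\frac s{h^4}-\frac{2A}{h^2}=\frac{(s-h^2A)^2}{h^4s}$. The
identity is exact, so no Taylor remainder has to be estimated. -/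
theorem saddle_exponent {A h v L j N s Λ : ℂ} (hh : h ≠ 0) (hw : A + h * v * Complex.I ≠ 0)
    (hA : A ^ 2 = L / j) (hN : N * h ^ 4 = 1) (hs : s = h ^ 2 * (A + h * v * Complex.I)) :
    Complex.exp (-(2 * A / h ^ 2)) * (Complex.exp Λ * Complex.exp (N * s)) =
      Complex.exp (Λ - L / (j * s)) * Complex.exp (-(v ^ 2 / (A + h * v * Complex.I))) := by
  have hN' : N = 1 / h ^ 4 := by field_simp; exact hN
  have hL : L / (j * s) = A ^ 2 / s := by rw [hA, div_div]
  rw [hL, hs, hN', ← Complex.exp_add, ← Complex.exp_add, ← Complex.exp_add]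
  congr 1
  field_simp
  linear_combination (v ^ 2 * h ^ 2) * Complex.I_sq

theorem re_inv_ge {α₀ K : ℝ} (hα₀ : 0 < α₀) {w : ℂ} (h1 : α₀ / 2 ≤ w.re) (h2 : w.re ≤ 2 * α₀)
    (h3 : |w.im| ≤ K) : α₀ / 2 / ((2 * α₀) ^ 2 + K ^ 2) ≤ (w⁻¹).re := by
  have hp : 0 < w.re := by linarith
  rw [Complex.inv_re, Complex.normSq_apply]
  have h4 : w.im * w.im ≤ K ^ 2 := by
    rw [← abs_mul_abs_self w.im]; nlinarith [abs_nonneg w.im]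
  gcongr <;> nlinarith

theorem integral_exp_neg_sq_div {A : ℂ} (hA : 0 < A.re) :
    ∫ v : ℝ, Complex.exp (-((v : ℂ) ^ 2 / A)) = (Real.pi * A) ^ (1 / 2 : ℂ) := by
  have hA0 : A ≠ 0 := by rintro rfl; simp at hA
  have h : 0 < (A⁻¹).re := by
    rw [Complex.inv_re]
    exact div_pos hA (Complex.normSq_pos.2 hA0)
  have := integral_gaussian_complex h
  rw [div_inv_eq_mul] at this
  rw [← this]
  congr 1; ext v
  congr 1
  field_simp

section

variable {ι : Type*} {l : Filter ι} [l.IsCountablyGenerated] {h : ι → ℝ} {z A N : ι → ℂ} {z₀ A₀ : ℂ}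

/-- The scale is $h=n^{-1/4}$: the saddle is $h^2A$ and the Gaussian has width $h^3$. Since
$K>|\mathrm{Im}\,A_0|$, the window contains the saddle strictly inside and fills the whole line
after rescaling. -/
theorem tendsto_major_arc (a : ℕ) {j : ℕ} (hj : 0 < j) (hh : Tendsto h l (𝓝[>] 0))
    (hz : Tendsto z l (𝓝 z₀)) (hz₀ : ‖z₀‖ < 1) (hA : Tendsto A l (𝓝 A₀)) (hA₀ : 0 < A₀.re)
    (hAz : ∀ᶠ i in l, A i ^ 2 = dilog (z i) / j) (hN : ∀ᶠ i in l, N i * (h i : ℂ) ^ 4 = 1)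
    {K : ℝ} (hK : |A₀.im| < K) :
    Tendsto (fun i => Complex.exp (-(2 * A i / (h i : ℂ) ^ 2)) * (((h i : ℂ) ^ 3)⁻¹ *
      ∫ t in (-(K * h i ^ 2))..(K * h i ^ 2),
        Complex.exp (logGen a j (z i) (((h i ^ 2 * (A i).re : ℝ) : ℂ) + t * Complex.I)) *
          Complex.exp (N i * (((h i ^ 2 * (A i).re : ℝ) : ℂ) + t * Complex.I)))) l
      (𝓝 (Complex.exp ((1 / 2 - a / j) * -Complex.log (1 - z₀)) *
        (Real.pi * A₀) ^ (1 / 2 : ℂ))) := by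
  have hK0 : 0 < K := (abs_nonneg _).trans_lt hK
  have hh0 : ∀ᶠ i in l, 0 < h i := hh.eventually self_mem_nhdsWithin
  have hh' : Tendsto h l (𝓝 0) := hh.mono_right nhdsWithin_le_nhds
  have hhc : Tendsto (fun i => (h i : ℂ)) l (𝓝 0) := by
    exact_mod_cast (Complex.continuous_ofReal.tendsto 0).comp hh'
  have hre : Tendsto (fun i => (A i).re) l (𝓝 A₀.re) := (Complex.continuous_re.tendsto _).comp hA
  have him : Tendsto (fun i => (A i).im) l (𝓝 A₀.im) := (Complex.continuous_im.tendsto _).comp hA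
  have hα1 : ∀ᶠ i in l, A₀.re / 2 < (A i).re := hre.eventually_const_lt (by linarith)
  have hα2 : ∀ᶠ i in l, (A i).re < 2 * A₀.re := hre.eventually_lt_const (by linarith)
  obtain ⟨r, hr, hr1⟩ := exists_between hz₀
  have hzr : ∀ᶠ i in l, ‖z i‖ < r := hz.norm.eventually_lt_const hr
  -- In the window $|\mathrm{Im}\,s|\le Kh^2$ and $\mathrm{Re}\,s\ge h^2\,\mathrm{Re}(A_0)/2$, so
  -- this is the slope of a sector containing it.
  have hK' : 0 ≤ 2 * K / A₀.re := by positivity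
  obtain ⟨C, hC0, hC⟩ := exists_norm_regKernel_le_of_sector a hj hK'
  set c := A₀.re / 2 / ((2 * A₀.re) ^ 2 + K ^ 2) with hc
  have hc0 : 0 < c := by positivity
  set D := Real.exp ((∑' m : ℕ, r ^ (m + 1)) * C) with hD
  set E : ι → ℝ → ℂ := fun i t =>
    Complex.exp (logGen a j (z i) (((h i ^ 2 * (A i).re : ℝ) : ℂ) + t * Complex.I)) *
          Complex.exp (N i * (((h i ^ 2 * (A i).re : ℝ) : ℂ) + t * Complex.I)) with hE
  set S : ι → Set ℝ := fun i => Ioc ((-K - (A i).im) / h i) ((K - (A i).im) / h i) with hS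
  have hmem : ∀ i, 0 < h i → ∀ v, v ∈ S i ↔ -K < (A i).im + h i * v ∧ (A i).im + h i * v ≤ K := by
    intro i hi v
    simp only [hS, mem_Ioc]
    rw [div_lt_iff₀ hi, le_div_iff₀ hi]
    constructor <;> rintro ⟨h1, h2⟩ <;> constructor <;> linarith
  -- The substitution $t=h^2\,\mathrm{Im}\,A+h^3v$ puts the saddle at $v=0$; its Jacobian cancels
  -- $h^{-3}$.
  have hsub : ∀ᶠ i in l, Complex.exp (-(2 * A i / (h i : ℂ) ^ 2)) * (((h i : ℂ) ^ 3)⁻¹ *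
      ∫ t in (-(K * h i ^ 2))..(K * h i ^ 2), E i t) =
      ∫ v : ℝ, (S i).indicator (fun v => Complex.exp (-(2 * A i / (h i : ℂ) ^ 2)) *
        E i (h i ^ 2 * (A i).im + h i ^ 3 * v)) v := by
    filter_upwards [hh0] with i hi
    have hle : (-K - (A i).im) / h i ≤ (K - (A i).im) / h i := by gcongr; linarith
    rw [MeasureTheory.integral_indicator measurableSet_Ioc, ← intervalIntegral.integral_of_le hle,
      intervalIntegral.integral_const_mul,
      intervalIntegral.integral_comp_add_mul (fun t => E i t) (by positivity), Complex.real_smul]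
    congr 2
    · push_cast; rfl
    · congr 1 <;> field_simp <;> ring
  have hkey : ∀ᶠ i in l, ∀ v : ℝ, Complex.exp (-(2 * A i / (h i : ℂ) ^ 2)) *
        E i (h i ^ 2 * (A i).im + h i ^ 3 * v) =
      Complex.exp (logGen a j (z i) ((h i : ℂ) ^ 2 * (A i + h i * v * Complex.I)) -
        dilog (z i) / (j * ((h i : ℂ) ^ 2 * (A i + h i * v * Complex.I)))) *
        Complex.exp (-((v : ℂ) ^ 2 / (A i + h i * v * Complex.I))) := by
    filter_upwards [hh0, hα1, hAz, hN] with i hi hαi hAi hNi v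
    have e : ((h i ^ 2 * (A i).re : ℝ) : ℂ) + ((h i ^ 2 * (A i).im + h i ^ 3 * v : ℝ) : ℂ) *
        Complex.I = (h i : ℂ) ^ 2 * (A i + h i * v * Complex.I) := by
      conv_rhs => rw [← Complex.re_add_im (A i)]
      push_cast; ring
    simp only [hE]
    rw [e]
    refine saddle_exponent (by exact_mod_cast hi.ne') ?_ hAi hNi rfl
    intro h0
    have := congrArg Complex.re h0
    simp at this
    linarith
  refine Tendsto.congr' (hsub.mono fun i hi => hi.symm) ?_
  have hlimeq : Complex.exp ((1 / 2 - a / j) * -Complex.log (1 - z₀)) *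
        (Real.pi * A₀) ^ (1 / 2 : ℂ) = ∫ v : ℝ,
      Complex.exp ((1 / 2 - a / j) * -Complex.log (1 - z₀)) * Complex.exp (-((v : ℂ) ^ 2 / A₀)) := by
    rw [MeasureTheory.integral_const_mul, integral_exp_neg_sq_div hA₀]
  rw [hlimeq]
  have hwre : ∀ i (v : ℝ), (A i + h i * v * Complex.I).re = (A i).re := fun i v => by simp
  have hwim : ∀ i (v : ℝ), (A i + h i * v * Complex.I).im = (A i).im + h i * v := fun i v => by simp
  have hsre : ∀ i (v : ℝ), ((h i : ℂ) ^ 2 * (A i + h i * v * Complex.I)).re =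
      h i ^ 2 * (A i).re := fun i v => by
    rw [← Complex.ofReal_pow, Complex.re_ofReal_mul, hwre]
  have hsim : ∀ i (v : ℝ), ((h i : ℂ) ^ 2 * (A i + h i * v * Complex.I)).im =
      h i ^ 2 * ((A i).im + h i * v) := fun i v => by
    rw [← Complex.ofReal_pow, Complex.im_ofReal_mul, hwim]
  have hsec : ∀ i (v : ℝ), A₀.re / 2 < (A i).re → |(A i).im + h i * v| ≤ K →
      |((h i : ℂ) ^ 2 * (A i + h i * v * Complex.I)).im| ≤
        2 * K / A₀.re * ((h i : ℂ) ^ 2 * (A i + h i * v * Complex.I)).re := by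
    intro i v hi hv
    rw [hsre, hsim, abs_mul, abs_of_nonneg (sq_nonneg (h i))]
    have : K ≤ 2 * K / A₀.re * (A i).re := by
      rw [div_mul_eq_mul_div, le_div_iff₀ hA₀]; nlinarith
    nlinarith [mul_le_mul_of_nonneg_left (hv.trans this) (sq_nonneg (h i))]
  refine MeasureTheory.tendsto_integral_filter_of_dominated_convergence
    (fun v => D * Real.exp (-c * v ^ 2)) ?_ ?_ ((integrable_exp_neg_mul_sq hc0).const_mul D) ?_
  · filter_upwards [hh0, hα1, hzr] with i hi hαi hzi
    refine AEMeasurable.aestronglyMeasurable (AEMeasurable.indicator ?_ measurableSet_Ioc)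
    refine (Continuous.mul continuous_const ?_).aemeasurable
    have hcl := continuous_logGen_line a hj (hzi.trans hr1) (σ := h i ^ 2 * (A i).re)
      (mul_pos (by positivity) (by linarith))
    have hEc : Continuous (E i) := (Complex.continuous_exp.comp hcl).mul (by fun_prop)
    exact hEc.comp (by fun_prop)
  · filter_upwards [hh0, hα1, hα2, hzr, hkey] with i hi hα1 hα2 hzi hkey
    refine Eventually.of_forall fun v => ?_
    by_cases hv : v ∈ S i
    · rw [indicator_of_mem hv, hkey, norm_mul, Complex.norm_exp, Complex.norm_exp]
      rw [hmem i hi] at hv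
      have hv' : |(A i).im + h i * v| ≤ K := abs_le.2 ⟨hv.1.le, hv.2⟩
      refine mul_le_mul ?_ ?_ (Real.exp_pos _).le (Real.exp_pos _).le
      · refine Real.exp_le_exp.2 ((Complex.re_le_norm _).trans ?_)
        exact norm_logGen_sub_le hj hC hr1 hzi.le
          (by rw [hsre]; exact mul_pos (by positivity) (by linarith)) (hsec i v hα1 hv')
      · refine Real.exp_le_exp.2 ?_
        have := re_inv_ge (K := K) hA₀ (w := A i + h i * v * Complex.I) (by rw [hwre]; exact hα1.le)
          (by rw [hwre]; exact hα2.le) (by rw [hwim]; exact hv')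
        rw [div_eq_mul_inv, ← Complex.ofReal_pow, Complex.neg_re, Complex.re_ofReal_mul]
        nlinarith [mul_le_mul_of_nonneg_left this (sq_nonneg v)]
    · rw [indicator_of_notMem hv, norm_zero]
      positivity
  · refine Eventually.of_forall fun v => ?_
    have hlw : Tendsto (fun i => A i + h i * v * Complex.I) l (𝓝 A₀) := by
      simpa using hA.add ((hhc.mul_const (v : ℂ)).mul_const Complex.I)
    have hlim' : Tendsto (fun i => (A i).im + h i * v) l (𝓝 A₀.im) := by
      simpa using him.add (hh'.mul_const v)
    have hin : ∀ᶠ i in l, |(A i).im + h i * v| < K := hlim'.abs.eventually_lt_const hK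
    have hls : Tendsto (fun i => (h i : ℂ) ^ 2 * (A i + h i * v * Complex.I)) l (𝓝 0) := by
      simpa using (hhc.pow 2).mul hlw
    have h1 := tendsto_logGen_sub_of_sector a hj hz hz₀ hls
      (by
        filter_upwards [hh0, hα1] with i hi hαi
        rw [hsre]; exact mul_pos (by positivity) (by linarith)) hK'
      (by
        filter_upwards [hα1, hin] with i hαi hini
        exact hsec i v hαi hini.le)
    have hA0 : A₀ ≠ 0 := by rintro h; rw [h] at hA₀; simp at hA₀
    have h2 := ((tendsto_const_nhds (x := (v : ℂ) ^ 2)).div hlw hA0).neg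
    refine Tendsto.congr' ?_ (((Complex.continuous_exp.tendsto _).comp h1).mul
      ((Complex.continuous_exp.tendsto _).comp h2))
    filter_upwards [hh0, hin, hkey] with i hi hini hkey
    rw [indicator_of_mem ((hmem i hi v).2 ⟨(abs_lt.1 hini).1, (abs_lt.1 hini).2.le⟩), hkey]
    rfl

end

/-! ### The minor arcs -/

/-- Since $2\,\mathrm{Re}\,s=s+\bar s$, one has $2\,\mathrm{Re}(s)\,L/s=L+L\bar s/s$, and the last
term has modulus $|L|$. This is how `dilogHeight` arises. -/
theorem re_div_le (L : ℂ) {s : ℂ} (hs : 0 < s.re) : (L / s).re ≤ (‖L‖ + L.re) / (2 * s.re) := by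
  have hs0 : s ≠ 0 := by rintro rfl; simp at hs
  have h1 : (L / s) * ((2 * s.re : ℝ) : ℂ) = L + L * (conj s / s) := by
    have : ((2 * s.re : ℝ) : ℂ) = s + conj s := by rw [Complex.add_conj]
    rw [this]; field_simp
  have h2 : (L * (conj s / s)).re ≤ ‖L‖ := by
    refine (Complex.re_le_norm _).trans ?_
    rw [norm_mul, norm_div, Complex.norm_conj, div_self (norm_ne_zero_iff.2 hs0), mul_one]
  have h3 := congrArg Complex.re h1
  rw [Complex.re_mul_ofReal, Complex.add_re] at h3
  rw [le_div_iff₀ (by positivity), h3]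
  linarith

theorem continuousAt_dilog {z : ℂ} (hz : ‖z‖ < 1) : ContinuousAt dilog z :=
  (hasDerivAt_dilog hz).continuousAt

theorem continuousAt_dilogHeight {z : ℂ} (hz : ‖z‖ < 1) : ContinuousAt dilogHeight z :=
  ((continuousAt_dilog hz).norm.add
    (Complex.continuous_re.continuousAt.comp (continuousAt_dilog hz))).div_const 2

section Minor

variable {ι : Type*} {l : Filter ι} {x α : ι → ℝ} {α₀ : ℝ} {w : ι → ℂ} {w₀ : ℂ}

/-- An upper bound for `logGen` near the imaginary axis, given a bound for its polar part. -/
theorem eventually_mul_re_logGen_le (a : ℕ) {j : ℕ} (hj : 0 < j) (hx : Tendsto x l (𝓝[>] 0))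
    (hα : Tendsto α l (𝓝 α₀)) (hα₀ : 0 < α₀) (hw : Tendsto w l (𝓝 w₀)) (hw₀ : ‖w₀‖ < 1)
    {T : ι → ℝ → Prop} {B B' : ℝ} (hBB : B' < B)
    (hB : Real.pi ^ 2 / 24 * ‖w₀‖ ^ 2 / (j * α₀) < B)
    (hT : ∀ᶠ i in l, ∀ t, T i t →
      x i * (dilog (w i) / (j * (x i * α i + t * Complex.I))).re ≤ B') :
    ∀ᶠ i in l, ∀ t ∈ Icc (-(Real.pi / j)) (Real.pi / j), T i t →
      x i * (logGen a j (w i) (x i * α i + t * Complex.I)).re ≤ B := by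
  have hK : IsCompact (Icc (-(Real.pi / j)) (Real.pi / j)) := isCompact_Icc
  -- The bound is local in `t`: near $t_0=0$ the polar part decides, elsewhere the root-of-unity
  -- estimate. Compactness of the interval then gives one event in `l` valid for all `t`.
  have key : ∀ t₀ ∈ Icc (-(Real.pi / j)) (Real.pi / j), ∀ᶠ p : ι × ℝ in l ×ˢ 𝓝 t₀,
      T p.1 p.2 → x p.1 * (logGen a j (w p.1) (x p.1 * α p.1 + p.2 * Complex.I)).re ≤ B := by
    intro t₀ ht₀
    have hx' : Tendsto (fun p : ι × ℝ => x p.1) (l ×ˢ 𝓝 t₀) (𝓝[>] 0) := hx.comp tendsto_fst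
    have hα' : Tendsto (fun p : ι × ℝ => α p.1) (l ×ˢ 𝓝 t₀) (𝓝 α₀) := hα.comp tendsto_fst
    have hw' : Tendsto (fun p : ι × ℝ => w p.1) (l ×ˢ 𝓝 t₀) (𝓝 w₀) := hw.comp tendsto_fst
    have hx0 : ∀ᶠ p : ι × ℝ in l ×ˢ 𝓝 t₀, 0 < x p.1 := hx'.eventually self_mem_nhdsWithin
    by_cases h0 : t₀ = 0
    · subst h0
      have h1 := tendsto_mul_logGen_sub_zero a hj hx' hα' hα₀ hw' hw₀ tendsto_snd
      have h2 := (Complex.continuous_re.tendsto _).comp h1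
      have h3 := h2.eventually_lt_const (show (0 : ℂ).re < B - B' by simpa using hBB)
      filter_upwards [h3, hT.prod_inl (𝓝 0)] with p hp hTp hpT
      have h4 := hTp p.2 hpT
      simp only [Function.comp_apply] at hp
      rw [Complex.re_ofReal_mul, Complex.sub_re, mul_sub] at hp
      linarith
    · have h1 := eventually_norm_mul_logGen_le a hj hx' hα' hα₀ hw' hw₀ tendsto_snd h0
        (abs_le.2 ht₀) hB
      filter_upwards [h1, hx0] with p hp hxp _
      exact (mul_le_mul_of_nonneg_left (Complex.re_le_norm _) hxp.le).trans hp
  have h2 : ∀ᶠ p : ι × ℝ in l ×ˢ 𝓝ˢ (Icc (-(Real.pi / j)) (Real.pi / j)),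
      T p.1 p.2 → x p.1 * (logGen a j (w p.1) (x p.1 * α p.1 + p.2 * Complex.I)).re ≤ B := by
    rw [hK.prod_nhdsSet_eq_biSup]
    simpa only [eventually_iSup] using key
  exact h2.curry.mono fun i hi t ht => hi.self_of_nhdsSet t ht

theorem eventually_mul_re_logGen_le_of_dilogHeight (a : ℕ) {j : ℕ} (hj : 0 < j)
    (hx : Tendsto x l (𝓝[>] 0)) (hα : Tendsto α l (𝓝 α₀)) (hα₀ : 0 < α₀)
    (hw : Tendsto w l (𝓝 w₀)) (hw₀ : ‖w₀‖ < 1) {B : ℝ}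
    (hB : Real.pi ^ 2 / 24 * ‖w₀‖ ^ 2 / (j * α₀) < B) (hB2 : dilogHeight w₀ / (j * α₀) < B) :
    ∀ᶠ i in l, ∀ t ∈ Icc (-(Real.pi / j)) (Real.pi / j),
      x i * (logGen a j (w i) (x i * α i + t * Complex.I)).re ≤ B := by
  obtain ⟨B', h1, h2⟩ := exists_between hB2
  have hj' : (0 : ℝ) < j := by exact_mod_cast hj
  have hx0 : ∀ᶠ i in l, 0 < x i := hx.eventually self_mem_nhdsWithin
  have hlim : Tendsto (fun i => dilogHeight (w i) / (j * α i)) l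
      (𝓝 (dilogHeight w₀ / (j * α₀))) :=
    ((continuousAt_dilogHeight hw₀).tendsto.comp hw).div (hα.const_mul _) (by positivity)
  have h := eventually_mul_re_logGen_le a hj hx hα hα₀ hw hw₀ (T := fun _ _ => True) h2 hB ?_
  · simpa using h
  · filter_upwards [hlim.eventually_lt_const h1, hx0, hα.eventually_const_lt hα₀] with i hi hxi hαi t _
    refine le_trans ?_ hi.le
    have hs : 0 < (j * (x i * α i + t * Complex.I) : ℂ).re := by
      simp; positivity
    have := re_div_le (dilog (w i)) hs
    have e : (j * (x i * α i + t * Complex.I) : ℂ).re = j * (x i * α i) := by simp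
    rw [e] at this
    calc _ ≤ x i * ((‖dilog (w i)‖ + (dilog (w i)).re) / (2 * (j * (x i * α i)))) := by gcongr
      _ = _ := by rw [dilogHeight]; field_simp

/-- This serves the unrotated weight, where the height is attained at the saddle and leaves no room.
Outside the window the gain comes from $|s|\ge|t|\ge Kx$ instead. -/
theorem eventually_mul_re_logGen_le_of_le_abs (a : ℕ) {j : ℕ} (hj : 0 < j)
    (hx : Tendsto x l (𝓝[>] 0)) (hα : Tendsto α l (𝓝 α₀)) (hα₀ : 0 < α₀)
    (hw : Tendsto w l (𝓝 w₀)) (hw₀ : ‖w₀‖ < 1) {B K : ℝ} (hK : 0 < K)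
    (hB : Real.pi ^ 2 / 24 * ‖w₀‖ ^ 2 / (j * α₀) < B) (hB2 : ‖dilog w₀‖ / (j * K) < B) :
    ∀ᶠ i in l, ∀ t ∈ Icc (-(Real.pi / j)) (Real.pi / j), K * x i ≤ |t| →
      x i * (logGen a j (w i) (x i * α i + t * Complex.I)).re ≤ B := by
  obtain ⟨B', h1, h2⟩ := exists_between hB2
  have hj' : (0 : ℝ) < j := by exact_mod_cast hj
  have hx0 : ∀ᶠ i in l, 0 < x i := hx.eventually self_mem_nhdsWithin
  have hlim : Tendsto (fun i => ‖dilog (w i)‖ / (j * K)) l (𝓝 (‖dilog w₀‖ / (j * K))) :=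
    ((continuousAt_dilog hw₀).tendsto.comp hw).norm.div_const _
  refine eventually_mul_re_logGen_le a hj hx hα hα₀ hw hw₀ (T := fun i t => K * x i ≤ |t|) h2 hB ?_
  filter_upwards [hlim.eventually_lt_const h1, hx0] with i hi hxi t ht
  refine le_trans ?_ hi.le
  have h3 : |t| ≤ ‖(x i * α i + t * Complex.I : ℂ)‖ := by
    have := Complex.abs_im_le_norm (x i * α i + t * Complex.I : ℂ)
    simpa using this
  have h4 : (dilog (w i) / (j * (x i * α i + t * Complex.I))).re ≤
      ‖dilog (w i)‖ / (j * (K * x i)) := by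
    refine (Complex.re_le_norm _).trans ?_
    rw [norm_div, norm_mul, Complex.norm_natCast]
    gcongr
    exact ht.trans h3
  calc _ ≤ x i * (‖dilog (w i)‖ / (j * (K * x i))) := by gcongr
    _ = _ := by field_simp

end Minor

theorem tendsto_exp_neg_div_sq_div_cube {δ : ℝ} (hδ : 0 < δ) :
    Tendsto (fun h : ℝ => Real.exp (-(δ / h ^ 2)) * (h ^ 3)⁻¹) (𝓝[>] 0) (𝓝 0) := by
  have h1 := tendsto_rpow_mul_exp_neg_mul_atTop_nhds_zero 3 δ hδ
  have h2 := h1.comp tendsto_inv_nhdsGT_zero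
  refine squeeze_zero' ?_ ?_ h2
  · filter_upwards [self_mem_nhdsWithin] with h hh
    have hh : 0 < h := hh
    positivity
  · filter_upwards [self_mem_nhdsWithin, nhdsWithin_le_nhds (Iic_mem_nhds one_pos)] with h hh hh1
    have hh : 0 < h := hh
    have hh1 : h ≤ 1 := hh1
    simp only [Function.comp_apply]
    rw [show (3 : ℝ) = (3 : ℕ) by norm_num, Real.rpow_natCast, inv_pow, mul_comm]
    gcongr
    rw [neg_mul, neg_le_neg_iff, ← div_eq_mul_inv]
    gcongr
    exact pow_le_of_le_one hh.le hh1 (by norm_num)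

/-- On the line $\mathrm{Re}\,s=h^2\,\mathrm{Re}\,A$ the factor $e^{Ns}$ costs
$e^{\mathrm{Re}(A)/h^2}$, half of what the normalisation removes. A bound $B<\mathrm{Re}\,A_0$ for
the other half leaves exponential decay, which beats $h^{-3}$. -/
theorem tendsto_minor_arc {ι : Type*} {l : Filter ι} {h : ι → ℝ} {w A N : ι → ℂ} {A₀ : ℂ}
    (a j : ℕ) (hh : Tendsto h l (𝓝[>] 0)) (hA : Tendsto A l (𝓝 A₀))
    (hN : ∀ᶠ i in l, N i * (h i : ℂ) ^ 4 = 1) {B : ℝ} (hB : B < A₀.re) {b c : ι → ℝ} {D : ℝ}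
    (hbc : ∀ᶠ i in l, |c i - b i| ≤ D)
    (hle : ∀ᶠ i in l, ∀ t ∈ uIcc (b i) (c i), h i ^ 2 * (logGen a j (w i)
      (((h i ^ 2 * (A i).re : ℝ) : ℂ) + t * Complex.I)).re ≤ B) :
    Tendsto (fun i => Complex.exp (-(2 * A i / (h i : ℂ) ^ 2)) * (((h i : ℂ) ^ 3)⁻¹ *
      ∫ t in (b i)..(c i),
        Complex.exp (logGen a j (w i) (((h i ^ 2 * (A i).re : ℝ) : ℂ) + t * Complex.I)) *
          Complex.exp (N i * (((h i ^ 2 * (A i).re : ℝ) : ℂ) + t * Complex.I)))) l (𝓝 0) := by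
  have hh0 : ∀ᶠ i in l, 0 < h i := hh.eventually self_mem_nhdsWithin
  have hre : Tendsto (fun i => (A i).re) l (𝓝 A₀.re) := (Complex.continuous_re.tendsto _).comp hA
  obtain ⟨α, hα1, hα2⟩ := exists_between hB
  have hlim := ((tendsto_exp_neg_div_sq_div_cube (sub_pos.2 hα1)).comp hh).mul_const D
  rw [zero_mul] at hlim
  refine squeeze_zero_norm' ?_ hlim
  filter_upwards [hh0, hN, hbc, hle, hre.eventually_const_lt hα2] with i hi hNi hbci hlei hαi
  have hN' : N i = (((h i ^ 4)⁻¹ : ℝ) : ℂ) := by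
    have : (h i : ℂ) ≠ 0 := by exact_mod_cast hi.ne'
    push_cast
    field_simp
    exact hNi
  have hint : ‖∫ t in (b i)..(c i),
        Complex.exp (logGen a j (w i) (((h i ^ 2 * (A i).re : ℝ) : ℂ) + t * Complex.I)) *
          Complex.exp (N i * (((h i ^ 2 * (A i).re : ℝ) : ℂ) + t * Complex.I))‖ ≤
      Real.exp (B / h i ^ 2) * Real.exp ((A i).re / h i ^ 2) * D := by
    refine (intervalIntegral.norm_integral_le_of_norm_le_const (C := Real.exp (B / h i ^ 2) *
      Real.exp ((A i).re / h i ^ 2)) fun t ht => ?_).trans (by gcongr)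
    rw [norm_mul, Complex.norm_exp, Complex.norm_exp]
    gcongr
    · rw [le_div_iff₀ (by positivity), mul_comm]
      exact hlei t (uIoc_subset_uIcc ht)
    · rw [hN', Complex.re_ofReal_mul]
      simp only [Complex.add_re, Complex.ofReal_re, Complex.mul_re, Complex.I_re, mul_zero,
        Complex.ofReal_im, Complex.I_im, mul_one, sub_self, add_zero]
      apply le_of_eq
      field_simp
  have hexp : ‖Complex.exp (-(2 * A i / (h i : ℂ) ^ 2))‖ = Real.exp (-(2 * (A i).re / h i ^ 2)) := by
    rw [Complex.norm_exp, ← Complex.ofReal_pow, Complex.neg_re, Complex.div_ofReal_re]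
    simp
  rw [norm_mul, norm_mul, hexp, norm_inv, norm_pow, Complex.norm_real, Real.norm_of_nonneg hi.le]
  calc _ ≤ Real.exp (-(2 * (A i).re / h i ^ 2)) * ((h i ^ 3)⁻¹ *
        (Real.exp (B / h i ^ 2) * Real.exp ((A i).re / h i ^ 2) * D)) := by gcongr
    _ = Real.exp (-(((A i).re - B) / h i ^ 2)) * (h i ^ 3)⁻¹ * D := by
      have : Real.exp (-(((A i).re - B) / h i ^ 2)) = Real.exp (-(2 * (A i).re / h i ^ 2)) *
          (Real.exp (B / h i ^ 2) * Real.exp ((A i).re / h i ^ 2)) := by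
        rw [← Real.exp_add, ← Real.exp_add]; congr 1; field_simp; ring
      rw [this]; ring
    _ ≤ _ := by
      simp only [Function.comp_apply]
      have hD : 0 ≤ D := (abs_nonneg _).trans hbci
      gcongr

/-! ### Branches of the roots and the shape of the main term -/

theorem arg_cpow_half {w : ℂ} (hw : w ≠ 0) : (w ^ (1 / 2 : ℂ)).arg = w.arg / 2 := by
  have him : (Complex.log w * (1 / 2 : ℂ)).im = w.arg / 2 := by
    have : (1 / 2 : ℂ) = ((1 / 2 : ℝ) : ℂ) := by push_cast; rfl
    rw [this, Complex.im_mul_ofReal, Complex.log_im]; ring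
  rw [Complex.cpow_def_of_ne_zero hw, ← Complex.log_im, Complex.log_exp, him]
  · rw [him]; linarith [Complex.neg_pi_lt_arg w, Real.pi_pos]
  · rw [him]; linarith [Complex.arg_le_pi w, Real.pi_pos]

theorem abs_arg_cpow_half_lt {w : ℂ} (hw : w ∈ Complex.slitPlane) :
    |(w ^ (1 / 2 : ℂ)).arg| < Real.pi / 2 := by
  obtain ⟨h1, h2⟩ := Complex.mem_slitPlane_iff_arg.1 hw
  rw [arg_cpow_half h2, abs_lt]
  have := lt_of_le_of_ne (Complex.arg_le_pi w) h1
  constructor <;> linarith [Complex.neg_pi_lt_arg w]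

theorem cpow_half_sq (w : ℂ) : (w ^ (1 / 2 : ℂ)) ^ 2 = w := by
  simp

theorem cpow_half_re_pos {w : ℂ} (hw : w ∈ Complex.slitPlane) : 0 < (w ^ (1 / 2 : ℂ)).re := by
  rcases Complex.abs_arg_lt_pi_div_two_iff.1 (abs_arg_cpow_half_lt hw) with h | h
  · exact h
  · have := cpow_half_sq w
    rw [h] at this
    exact absurd (by rw [← this]; simp) (Complex.slitPlane_ne_zero hw)

theorem dilog_mem_slitPlane {z : ℂ} (hz : 0 < dilogHeight z) : dilog z ∈ Complex.slitPlane := by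
  by_contra h
  rw [Complex.mem_slitPlane_iff] at h
  push Not at h
  obtain ⟨h1, h2⟩ := h
  have : ‖dilog z‖ = -(dilog z).re := by
    rw [← Complex.re_add_im (dilog z), h2]
    simp [abs_of_nonpos h1]
  rw [dilogHeight, this] at hz
  simp at hz

theorem dilog_div_mem_slitPlane {z : ℂ} (hz : 0 < dilogHeight z) {j : ℕ} (hj : 0 < j) :
    dilog z / j ∈ Complex.slitPlane := by
  have hj' : (0 : ℝ) < (j : ℝ)⁻¹ := by positivity
  have h := dilog_mem_slitPlane hz
  rw [Complex.mem_slitPlane_iff_arg] at h ⊢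
  have e : dilog z / j = dilog z * ((j : ℝ)⁻¹ : ℝ) := by push_cast; rfl
  rw [e, Complex.arg_mul_real hj']
  exact ⟨h.1, mul_ne_zero h.2 (by exact_mod_cast hj'.ne')⟩

/-- From $|A|^2+\mathrm{Re}(A^2)=2(\mathrm{Re}\,A)^2$. It turns height comparisons into the
condition $B<\mathrm{Re}\,A_0$ of `tendsto_minor_arc`. -/
theorem dilogHeight_eq (z : ℂ) {j : ℕ} (hj : 0 < j) :
    dilogHeight z = j * ((dilog z / j) ^ (1 / 2 : ℂ)).re ^ 2 := by
  have hj' : (j : ℂ) ≠ 0 := by exact_mod_cast hj.ne'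
  have h1 : dilog z = ((j : ℝ) : ℂ) * ((dilog z / j) ^ (1 / 2 : ℂ)) ^ 2 := by
    rw [cpow_half_sq]; push_cast; field_simp
  set A := (dilog z / j) ^ (1 / 2 : ℂ)
  rw [dilogHeight, h1, Complex.re_ofReal_mul, norm_mul, norm_pow, Complex.norm_real,
    Real.norm_of_nonneg (by positivity), Complex.sq_norm, Complex.normSq_apply, pow_two A,
    Complex.mul_re]
  ring

/-- Fourth powers and squares agree by algebra; the principal branches agree because $|\arg
A|<\pi/2$, so that $(\pi A)^{1/2}$ has argument below $\pi/4$ in modulus. -/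
theorem mainTerm_eq {a j n : ℕ} {z : ℂ} (hz : 0 < dilogHeight z) (hj : 0 < j) {h : ℝ} (hh : 0 < h)
    (hn : (n : ℂ) * (h : ℂ) ^ 4 = 1) :
    mainTerm a j n z = (1 - z) ^ ((2 * (a : ℂ) - j) / (2 * j)) *
      ((Real.pi * (dilog z / j) ^ (1 / 2 : ℂ)) ^ (1 / 2 : ℂ) * (h ^ 3 / (2 * Real.pi) : ℝ)) *
      Complex.exp (2 * (dilog z / j) ^ (1 / 2 : ℂ) / (h : ℂ) ^ 2) := by
  have hj' : (j : ℂ) ≠ 0 := by exact_mod_cast hj.ne'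
  have hh' : (h : ℂ) ≠ 0 := by exact_mod_cast hh.ne'
  have hpi : (Real.pi : ℂ) ≠ 0 := by exact_mod_cast Real.pi_ne_zero
  have hn' : (n : ℂ) = 1 / (h : ℂ) ^ 4 := by field_simp; exact hn
  have hs := dilog_div_mem_slitPlane hz hj
  have hA2 := cpow_half_sq (dilog z / j)
  have harg := abs_lt.1 (abs_arg_cpow_half_lt hs)
  have hre := cpow_half_re_pos hs
  set A := (dilog z / j) ^ (1 / 2 : ℂ) with hA
  have hL : dilog z = j * A ^ 2 := by rw [hA2]; field_simp
  have hA0 : A ≠ 0 := by rintro h; rw [h] at hre; simp at hre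
  have hargπ : (Real.pi * A : ℂ).arg = A.arg := Complex.arg_real_mul A Real.pi_pos
  set u : ℂ := (Real.pi * A) ^ (1 / 2 : ℂ) * (h ^ 3 / (2 * Real.pi) : ℝ) with hu
  have hargu : u.arg = A.arg / 2 := by
    rw [hu, Complex.arg_mul_real (by positivity), arg_cpow_half (mul_ne_zero hpi hA0), hargπ]
  have h4 : (dilog z / (16 * j * (Real.pi : ℂ) ^ 2 * (n : ℂ) ^ 3)) ^ (1 / 4 : ℂ) = u := by
    have e : dilog z / (16 * j * (Real.pi : ℂ) ^ 2 * (n : ℂ) ^ 3) = u ^ 4 := by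
      rw [hu, mul_pow, show 4 = 2 * 2 by norm_num, pow_mul, cpow_half_sq, hL, hn']
      push_cast
      field_simp
      ring
    have := Complex.pow_cpow_nat_inv (x := u) (n := 4) (by norm_num)
      (by rw [hargu]; push_cast; linarith) (by rw [hargu]; push_cast; linarith)
    rw [e, show (1 / 4 : ℂ) = ((4 : ℕ) : ℂ)⁻¹ by norm_num]
    exact this
  have h2 : ((n : ℂ) * dilog z / j) ^ (1 / 2 : ℂ) = A / (h : ℂ) ^ 2 := by
    have hargv : (A / (h : ℂ) ^ 2).arg = A.arg := by
      have : A / (h : ℂ) ^ 2 = A * (((h ^ 2)⁻¹ : ℝ) : ℂ) := by push_cast; rfl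
      rw [this, Complex.arg_mul_real (by positivity)]
    have e : (n : ℂ) * dilog z / j = (A / (h : ℂ) ^ 2) ^ 2 := by
      rw [hL, hn']; field_simp
    have := Complex.pow_cpow_nat_inv (x := A / (h : ℂ) ^ 2) (n := 2) (by norm_num)
      (by rw [hargv]; push_cast; linarith) (by rw [hargv]; push_cast; linarith)
    rw [e]
    simpa using this
  rw [mainTerm, h4, h2, mul_div_assoc]

/-! ### Rotations by roots of unity -/

/-- With $\psi=\pi m/j$ and $\theta=\arg z$,
$\cos(\theta-2\psi)-\cos\theta=2\sin(\theta-\psi)\sin\psi$. Since $\pi/j\le\psi\le\pi-\pi/j$, the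
bound on $\theta$ makes the first sine negative. -/
theorem re_rotation_lt {j m : ℕ} (hm0 : 0 < m) (hmj : m < j) {z : ℂ} (hz : z ≠ 0)
    (harg : |z.arg| < Real.pi / j) :
    (z * Complex.exp (-(2 * Real.pi * Complex.I * m / j))).re < z.re := by
  have hj' : (0 : ℝ) < j := by exact_mod_cast (Nat.zero_le m).trans_lt hmj
  set ψ : ℝ := Real.pi * m / j with hψ
  have e : z * Complex.exp (-(2 * Real.pi * Complex.I * m / j)) =
      (‖z‖ : ℂ) * Complex.exp (((z.arg - 2 * ψ : ℝ) : ℂ) * Complex.I) := by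
    conv_lhs => rw [← Complex.norm_mul_exp_arg_mul_I z]
    rw [mul_assoc, ← Complex.exp_add]
    congr 2
    rw [hψ]; push_cast; ring
  rw [e, Complex.re_ofReal_mul, Complex.exp_ofReal_mul_I_re, ← Complex.norm_mul_cos_arg z]
  refine mul_lt_mul_of_pos_left ?_ (norm_pos_iff.2 hz)
  have h1 : Real.pi / j ≤ ψ := by
    rw [hψ]; gcongr
    have : (1 : ℝ) ≤ m := by exact_mod_cast hm0
    nlinarith [Real.pi_pos]
  have h2 : ψ ≤ Real.pi - Real.pi / j := by
    have : (m : ℝ) + 1 ≤ j := by exact_mod_cast hmj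
    rw [hψ, le_sub_iff_add_le, ← add_div, div_le_iff₀ hj']
    nlinarith [Real.pi_pos]
  have hp : 0 < Real.pi / j := div_pos Real.pi_pos hj'
  obtain ⟨h3, h4⟩ := abs_lt.1 harg
  have s1 : 0 < Real.sin ψ := Real.sin_pos_of_pos_of_lt_pi (by linarith) (by linarith)
  have s2 : Real.sin (z.arg - ψ) < 0 :=
    Real.sin_neg_of_neg_of_neg_pi_lt (by linarith) (by linarith)
  have h5 : Real.cos (z.arg - 2 * ψ) - Real.cos z.arg = 2 * (Real.sin (z.arg - ψ) * Real.sin ψ) := by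
    rw [Real.cos_sub_cos]
    rw [show (z.arg - 2 * ψ + z.arg) / 2 = z.arg - ψ by ring,
      show (z.arg - 2 * ψ - z.arg) / 2 = -ψ by ring, Real.sin_neg]
    ring
  nlinarith [mul_neg_of_neg_of_pos s2 s1]

theorem re_rotation_mul_lt {a j k : ℕ} (hcop : a.Coprime j) (hk0 : 0 < k) (hkj : k < j) {z : ℂ}
    (hz : z ≠ 0) (harg : |z.arg| < Real.pi / j) :
    (z * Complex.exp (-(2 * Real.pi * Complex.I * k * a / j))).re < z.re := by
  have hj : 0 < j := hk0.trans hkj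
  have hj' : (j : ℂ) ≠ 0 := by exact_mod_cast hj.ne'
  -- Coprimality enters here: distinct arcs carry distinct rotations of $z$, so no other arc repeats
  -- the main one.
  have hm : 0 < k * a % j := by
    refine Nat.pos_of_ne_zero fun h => ?_
    have := (hcop.symm.dvd_of_dvd_mul_right (Nat.dvd_of_mod_eq_zero h))
    exact absurd (Nat.le_of_dvd hk0 this) (not_le.2 hkj)
  have e : Complex.exp (-(2 * Real.pi * Complex.I * k * a / j)) =
      Complex.exp (-(2 * Real.pi * Complex.I * (k * a % j : ℕ) / j)) := by
    rw [Complex.exp_eq_exp_iff_exists_int]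
    refine ⟨-(k * a / j : ℕ), ?_⟩
    have h : ((k * a % j : ℕ) : ℂ) + j * (k * a / j : ℕ) = k * a := by
      exact_mod_cast congrArg (Nat.cast (R := ℂ)) (Nat.mod_add_div (k * a) j)
    have h' : (2 * Real.pi * Complex.I * k * a : ℂ) =
      2 * Real.pi * Complex.I * (((k * a % j : ℕ) : ℂ) + j * (k * a / j : ℕ)) := by rw [h]; ring
    rw [h', Int.cast_neg, Int.cast_natCast]
    field_simp
    ring
  rw [e]
  exact re_rotation_lt hm (Nat.mod_lt _ hj) hz harg

theorem sum_modEq_card_mul {a j : ℕ} (s : Multiset ℕ) (h : ∀ i ∈ s, i ≡ a [MOD j]) :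
    s.sum ≡ s.card * a [MOD j] := by
  induction s using Multiset.induction_on with
  | empty => simp [Nat.ModEq]
  | cons i s ih =>
    rw [Multiset.sum_cons, Multiset.card_cons, add_mul, one_mul, add_comm]
    exact (ih fun k hk => h k (Multiset.mem_cons_of_mem hk)).add (h i (Multiset.mem_cons_self i s))

theorem weightedPartitionCount_rotation (a : ℕ) {j : ℕ} (hj : 0 < j) (n : ℕ) (t : ℤ) (z : ℂ) :
    weightedPartitionCount a j n (Complex.exp (2 * Real.pi * Complex.I * t * a / j) * z) =
      Complex.exp (2 * Real.pi * Complex.I * t * n / j) * weightedPartitionCount a j n z := by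
  have hj' : (j : ℂ) ≠ 0 := by exact_mod_cast hj.ne'
  rw [weightedPartitionCount, weightedPartitionCount, Finset.mul_sum]
  refine Finset.sum_congr rfl fun p hp => ?_
  have h := sum_modEq_card_mul p.parts (Finset.mem_filter.1 hp).2
  rw [p.parts_sum, Nat.modEq_iff_dvd] at h
  obtain ⟨c, hc⟩ := h
  have hc' : (p.parts.card : ℂ) * a - n = j * c := by exact_mod_cast congrArg (Int.cast (R := ℂ)) hc
  rw [mul_pow, ← Complex.exp_nat_mul]
  congr 1
  rw [Complex.exp_eq_exp_iff_exists_int]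
  refine ⟨t * c, ?_⟩
  push_cast
  field_simp
  linear_combination (t : ℂ) * hc'

/-! ### Assembling the arcs -/

theorem tendsto_normalized_weightedPartitionCount {a j : ℕ} (ha : 0 < a) (haj : a < j)
    (hj : 2 < j) (hcop : a.Coprime j) {z₀ : ℂ} (hz₀ : z₀ ∈ openSector j) {ι : Type*} {l : Filter ι}
    [l.IsCountablyGenerated] {n : ι → ℕ} {h : ι → ℝ} {z : ι → ℂ} (hh : Tendsto h l (𝓝[>] 0))
    (hz : Tendsto z l (𝓝 z₀)) (hn : ∀ᶠ i in l, (n i : ℂ) * (h i : ℂ) ^ 4 = 1) :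
    Tendsto (fun i => Complex.exp (-(2 * (dilog (z i) / j) ^ (1 / 2 : ℂ) / (h i : ℂ) ^ 2)) *
      (((h i : ℂ) ^ 3)⁻¹ * (weightedPartitionCount a j (n i) (z i) * (2 * Real.pi)))) l
      (𝓝 (Complex.exp ((1 / 2 - a / j) * -Complex.log (1 - z₀)) *
        (Real.pi * (dilog z₀ / j) ^ (1 / 2 : ℂ)) ^ (1 / 2 : ℂ))) := by
  obtain ⟨hz0, hz1, harg⟩ := hz₀
  have hj0 : 0 < j := ha.trans haj
  have hjr : (0 : ℝ) < j := by exact_mod_cast hj0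
  have hD : Real.pi ^ 2 / 24 * ‖z₀‖ ^ 2 < dilogHeight z₀ := by
    refine lt_dilogHeight hz0 hz1 (harg.le.trans ?_)
    have : (3 : ℝ) ≤ j := by exact_mod_cast hj
    gcongr
  have hD0 : 0 < dilogHeight z₀ := lt_of_le_of_lt (by positivity) hD
  have hslit := dilog_div_mem_slitPlane hD0 hj0
  have hA₀ := cpow_half_re_pos hslit
  have hheight := dilogHeight_eq z₀ hj0
  have hAcont : ContinuousAt (fun z => (dilog z / j) ^ (1 / 2 : ℂ)) z₀ :=
    ((continuousAt_dilog hz1).div_const _).cpow continuousAt_const hslit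
  have hA : Tendsto (fun i => (dilog (z i) / j) ^ (1 / 2 : ℂ)) l
      (𝓝 ((dilog z₀ / j) ^ (1 / 2 : ℂ))) := hAcont.tendsto.comp hz
  have hAz : ∀ i, ((dilog (z i) / j) ^ (1 / 2 : ℂ)) ^ 2 = dilog (z i) / j :=
    fun i => cpow_half_sq _
  set A : ι → ℂ := fun i => (dilog (z i) / j) ^ (1 / 2 : ℂ) with hAdef
  set A₀ := (dilog z₀ / j) ^ (1 / 2 : ℂ) with hA₀def
  have hα : Tendsto (fun i => (A i).re) l (𝓝 A₀.re) := (Complex.continuous_re.tendsto _).comp hA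
  have hx : Tendsto (fun i => h i ^ 2) l (𝓝[>] 0) := by
    refine tendsto_nhdsWithin_iff.2 ⟨?_, ?_⟩
    · simpa using (hh.mono_right nhdsWithin_le_nhds).pow 2
    · filter_upwards [hh.eventually self_mem_nhdsWithin] with i hi
      exact pow_pos hi 2
  have hh0 : ∀ᶠ i in l, 0 < h i := hh.eventually self_mem_nhdsWithin
  have hBz : Real.pi ^ 2 / 24 * ‖z₀‖ ^ 2 / (j * A₀.re) < A₀.re := by
    rw [div_lt_iff₀ (by positivity)]
    calc _ < _ := hD
      _ = _ := by rw [hheight]; ring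
  have hpj : 0 < Real.pi / j := div_pos Real.pi_pos hjr
  have hminor : ∀ k ∈ Finset.range j, k ≠ 0 → Tendsto (fun i =>
      Complex.exp (-(2 * A i / (h i : ℂ) ^ 2)) * (((h i : ℂ) ^ 3)⁻¹ *
      ∫ t in (-(Real.pi / j))..(Real.pi / j),
        Complex.exp (logGen a j (z i * Complex.exp (-(2 * Real.pi * Complex.I * k * a / j)))
          (((h i ^ 2 * (A i).re : ℝ) : ℂ) + t * Complex.I)) *
          Complex.exp (n i * (((h i ^ 2 * (A i).re : ℝ) : ℂ) + t * Complex.I)))) l (𝓝 0) := by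
    intro k hk hk0
    have hw : Tendsto (fun i => z i * Complex.exp (-(2 * Real.pi * Complex.I * k * a / j))) l
        (𝓝 (z₀ * Complex.exp (-(2 * Real.pi * Complex.I * k * a / j)))) := hz.mul_const _
    have hwn : ‖z₀ * Complex.exp (-(2 * Real.pi * Complex.I * k * a / j))‖ = ‖z₀‖ := by
      have : (-(2 * Real.pi * Complex.I * k * a / j) : ℂ) =
          ((-(2 * Real.pi * k * a / j) : ℝ) : ℂ) * Complex.I := by push_cast; ring
      rw [norm_mul, this, Complex.norm_exp_ofReal_mul_I, mul_one]
    have hlt := dilogHeight_lt_of_re_lt hz1 hwn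
      (re_rotation_mul_lt hcop (Nat.pos_of_ne_zero hk0) (Finset.mem_range.1 hk) hz0 harg)
    have hB2 : dilogHeight (z₀ * Complex.exp (-(2 * Real.pi * Complex.I * k * a / j))) /
        (j * A₀.re) < A₀.re := by
      rw [div_lt_iff₀ (by positivity)]
      calc _ < _ := hlt
        _ = _ := by rw [hheight]; ring
    obtain ⟨B, hB, hBA⟩ := exists_between (max_lt hBz hB2)
    rw [max_lt_iff] at hB
    refine tendsto_minor_arc a j hh hA hn hBA (D := 2 * (Real.pi / j))
      (Eventually.of_forall fun i => ?_) ?_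
    · rw [abs_of_pos] <;> linarith
    · have := eventually_mul_re_logGen_le_of_dilogHeight a hj0 hx hα hA₀ hw (hwn.trans_lt hz1)
        (by rw [hwn]; exact hB.1) hB.2
      filter_upwards [this] with i hi t ht
      rw [uIcc_of_le (by linarith)] at ht
      have := hi t ht
      rwa [← Complex.ofReal_mul] at this
  obtain ⟨B, hB, hBA⟩ := exists_between hBz
  have hBpos : 0 < B := lt_of_le_of_lt (by positivity) hB
  -- The first condition puts the saddle inside the window; the second makes the polar part smaller
  -- than `B` outside it.
  obtain ⟨K, hK1, hK2⟩ : ∃ K : ℝ, |A₀.im| < K ∧ ‖dilog z₀‖ / (j * B) < K :=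
    ⟨max |A₀.im| (‖dilog z₀‖ / (j * B)) + 1, by linarith [le_max_left |A₀.im| (‖dilog z₀‖ / (j * B))],
      by linarith [le_max_right |A₀.im| (‖dilog z₀‖ / (j * B))]⟩
  have hK0 : 0 < K := (abs_nonneg _).trans_lt hK1
  have hfar := eventually_mul_re_logGen_le_of_le_abs a hj0 hx hα hA₀ hz hz1 hK0 hB (by
    rw [div_lt_iff₀ (by positivity)] at hK2 ⊢
    linarith)
  have hKx : ∀ᶠ i in l, K * h i ^ 2 < Real.pi / j := by
    have : Tendsto (fun i => K * h i ^ 2) l (𝓝 0) := by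
      simpa using (hx.mono_right nhdsWithin_le_nhds).const_mul K
    exact this.eventually_lt_const hpj
  have hleft := tendsto_minor_arc (w := z) (b := fun _ => -(Real.pi / j))
    (c := fun i => -(K * h i ^ 2)) a j hh hA hn hBA (D := Real.pi / j)
    (by
      filter_upwards [hKx, hh0] with i hi hhi
      have : 0 < K * h i ^ 2 := by positivity
      rw [abs_of_pos] <;> linarith)
    (by
      filter_upwards [hKx, hh0, hfar] with i hi hhi hfi t ht
      have : 0 < K * h i ^ 2 := by positivity
      rw [uIcc_of_le (by linarith)] at ht
      have := hfi t ⟨ht.1, by linarith [ht.2]⟩ (by rw [abs_of_neg] <;> linarith [ht.2])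
      rwa [← Complex.ofReal_mul] at this)
  have hright := tendsto_minor_arc (w := z) (b := fun i => K * h i ^ 2)
    (c := fun _ => Real.pi / j) a j hh hA hn hBA (D := Real.pi / j)
    (by
      filter_upwards [hKx, hh0] with i hi hhi
      have : 0 < K * h i ^ 2 := by positivity
      rw [abs_of_pos] <;> linarith)
    (by
      filter_upwards [hKx, hh0, hfar] with i hi hhi hfi t ht
      have : 0 < K * h i ^ 2 := by positivity
      rw [uIcc_of_le (by linarith)] at ht
      have := hfi t ⟨by linarith [ht.1], ht.2⟩ (by rw [abs_of_pos] <;> linarith [ht.1])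
      rwa [← Complex.ofReal_mul] at this)
  have hmajor := tendsto_major_arc a hj0 hh hz hz1 hA hA₀ (Eventually.of_forall hAz) hn hK1
  have hzero := (hleft.add hmajor).add hright
  rw [zero_add, add_zero] at hzero
  -- Only $k=0$ has a nonzero limit; there the window and its two flanks are glued back into the
  -- full arc. For the other $k$ the prefactor is unimodular and cannot affect a zero limit.
  have hsum := tendsto_finsetSum (Finset.range j) (fun k hk => (by
    rcases eq_or_ne k 0 with hk0 | hk0
    · subst hk0
      rw [if_pos rfl]
      refine hzero.congr' ?_
      filter_upwards [hh0, hα.eventually_const_lt hA₀, hz.norm.eventually_lt_const hz1] with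
        i hi hαi hzi
      have hcl := continuous_logGen_line a hj0 hzi (σ := h i ^ 2 * (A i).re) (by positivity)
      have hc : Continuous fun t : ℝ =>
          Complex.exp (logGen a j (z i) (((h i ^ 2 * (A i).re : ℝ) : ℂ) + t * Complex.I)) *
          Complex.exp (n i * (((h i ^ 2 * (A i).re : ℝ) : ℂ) + t * Complex.I)) :=
        (Complex.continuous_exp.comp hcl).mul (by fun_prop)
      have e : (2 * Real.pi * Complex.I * (0 : ℕ) * n i / j : ℂ) = 0 := by simp
      have e' : Complex.exp (-(2 * Real.pi * Complex.I * (0 : ℕ) * a / j : ℂ)) = 1 := by simp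
      rw [← mul_add, ← mul_add, ← mul_add, ← mul_add,
        intervalIntegral.integral_add_adjacent_intervals (hc.intervalIntegrable _ _)
          (hc.intervalIntegrable _ _),
        intervalIntegral.integral_add_adjacent_intervals (hc.intervalIntegrable _ _)
          (hc.intervalIntegrable _ _)]
      rw [e, e', Complex.exp_zero, one_mul, mul_one]
    · rw [if_neg hk0]
      refine squeeze_zero_norm (fun i => ?_) ((tendsto_zero_iff_norm_tendsto_zero).1 (hminor k hk hk0))
      have : (2 * Real.pi * Complex.I * k * n i / j : ℂ) =
          ((2 * Real.pi * k * n i / j : ℝ) : ℂ) * Complex.I := by push_cast; ring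
      rw [norm_mul, this, Complex.norm_exp_ofReal_mul_I, one_mul] :
    Tendsto (fun i => Complex.exp (2 * Real.pi * Complex.I * k * n i / j) *
      (Complex.exp (-(2 * A i / (h i : ℂ) ^ 2)) * (((h i : ℂ) ^ 3)⁻¹ *
      ∫ t in (-(Real.pi / j))..(Real.pi / j),
        Complex.exp (logGen a j (z i * Complex.exp (-(2 * Real.pi * Complex.I * k * a / j)))
          (((h i ^ 2 * (A i).re : ℝ) : ℂ) + t * Complex.I)) *
          Complex.exp (n i * (((h i ^ 2 * (A i).re : ℝ) : ℂ) + t * Complex.I))))) l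
      (𝓝 (if k = 0 then Complex.exp ((1 / 2 - a / j) * -Complex.log (1 - z₀)) *
        (Real.pi * A₀) ^ (1 / 2 : ℂ) else 0))))
  rw [Finset.sum_ite_eq', if_pos (Finset.mem_range.2 hj0)] at hsum
  refine hsum.congr' ?_
  filter_upwards [hh0, hα.eventually_const_lt hA₀, hz.norm.eventually_lt_const hz1] with i hi hαi hzi
  rw [weightedPartitionCount_mul_two_pi_eq_sum ha haj (n i) hzi (σ := h i ^ 2 * (A i).re)
    (by positivity), Finset.mul_sum, Finset.mul_sum]
  exact Finset.sum_congr rfl fun k _ => by ring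

theorem tendsto_weightedPartitionCount_div_mainTerm {a j : ℕ} (ha : 0 < a) (haj : a < j)
    (hj : 2 < j) (hcop : a.Coprime j) {z₀ : ℂ} (hz₀ : z₀ ∈ openSector j) :
    Tendsto (fun p : ℕ × ℂ => weightedPartitionCount a j p.1 p.2 / mainTerm a j p.1 p.2)
      (atTop ×ˢ 𝓝 z₀) (𝓝 1) := by
  have hj0 : 0 < j := ha.trans haj
  have hjc : (j : ℂ) ≠ 0 := by exact_mod_cast hj0.ne'
  set h : ℕ × ℂ → ℝ := fun p => (p.1 : ℝ) ^ (-(1 / 4) : ℝ) with hhdef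
  have hn1 : ∀ᶠ p : ℕ × ℂ in atTop ×ˢ 𝓝 z₀, 0 < p.1 :=
    tendsto_fst.eventually (eventually_gt_atTop 0)
  have hh0 : ∀ᶠ p : ℕ × ℂ in atTop ×ˢ 𝓝 z₀, 0 < h p := by
    filter_upwards [hn1] with p hp
    exact Real.rpow_pos_of_pos (by exact_mod_cast hp) _
  have hh : Tendsto h (atTop ×ˢ 𝓝 z₀) (𝓝[>] 0) := by
    refine tendsto_nhdsWithin_iff.2 ⟨?_, hh0⟩
    exact (tendsto_rpow_neg_atTop (by norm_num)).comp
      (tendsto_natCast_atTop_atTop.comp tendsto_fst)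
  have hn : ∀ᶠ p : ℕ × ℂ in atTop ×ˢ 𝓝 z₀, (p.1 : ℂ) * (h p : ℂ) ^ 4 = 1 := by
    filter_upwards [hn1] with p hp
    have hp' : (0 : ℝ) < p.1 := by exact_mod_cast hp
    have : (p.1 : ℝ) * h p ^ 4 = 1 := by
      rw [hhdef]
      simp only
      rw [← Real.rpow_natCast, ← Real.rpow_mul hp'.le]
      norm_num
      rw [Real.rpow_neg_one]
      exact mul_inv_cancel₀ hp'.ne'
    exact_mod_cast this
  have hz : Tendsto (fun p : ℕ × ℂ => p.2) (atTop ×ˢ 𝓝 z₀) (𝓝 z₀) := tendsto_snd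
  have key := tendsto_normalized_weightedPartitionCount ha haj hj hcop hz₀ hh hz hn
  obtain ⟨hz0, hz1, harg⟩ := hz₀
  have hD0 : 0 < dilogHeight z₀ := by
    refine lt_of_le_of_lt (by positivity) (lt_dilogHeight hz0 hz1 (harg.le.trans ?_))
    have : (3 : ℝ) ≤ j := by exact_mod_cast hj
    gcongr
  have hslit := dilog_div_mem_slitPlane hD0 hj0
  have hA₀ := cpow_half_re_pos hslit
  have hAcont : ContinuousAt (fun z => (dilog z / j) ^ (1 / 2 : ℂ)) z₀ :=
    ((continuousAt_dilog hz1).div_const _).cpow continuousAt_const hslit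
  have hπA : (Real.pi * (dilog z₀ / j) ^ (1 / 2 : ℂ) : ℂ) ∈ Complex.slitPlane := by
    left
    rw [Complex.re_ofReal_mul]
    exact mul_pos Real.pi_pos hA₀
  have hden : Tendsto (fun p : ℕ × ℂ => (1 - p.2) ^ ((2 * (a : ℂ) - j) / (2 * j)) *
      (Real.pi * (dilog p.2 / j) ^ (1 / 2 : ℂ)) ^ (1 / 2 : ℂ)) (atTop ×ˢ 𝓝 z₀)
      (𝓝 (Complex.exp ((1 / 2 - a / j) * -Complex.log (1 - z₀)) *
        (Real.pi * (dilog z₀ / j) ^ (1 / 2 : ℂ)) ^ (1 / 2 : ℂ))) := by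
    have e : Complex.exp ((1 / 2 - a / j) * -Complex.log (1 - z₀)) =
        (1 - z₀) ^ ((2 * (a : ℂ) - j) / (2 * j)) := by
      rw [Complex.cpow_def_of_ne_zero (one_sub_ne_zero_of_norm_lt_one hz1)]
      congr 1
      field_simp
      ring
    rw [e]
    have hc : ContinuousAt (fun z : ℂ => (1 - z) ^ ((2 * (a : ℂ) - j) / (2 * j)) *
      (Real.pi * (dilog z / j) ^ (1 / 2 : ℂ)) ^ (1 / 2 : ℂ)) z₀ := by
      refine ContinuousAt.mul ?_ ?_
      · exact (by fun_prop : ContinuousAt (fun z : ℂ => 1 - z) z₀).cpow continuousAt_const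
          (one_sub_mem_slitPlane hz1)
      · exact (continuousAt_const.mul hAcont).cpow continuousAt_const hπA
    exact hc.tendsto.comp hz
  have hne : Complex.exp ((1 / 2 - a / j) * -Complex.log (1 - z₀)) *
        (Real.pi * (dilog z₀ / j) ^ (1 / 2 : ℂ)) ^ (1 / 2 : ℂ) ≠ 0 := by
    refine mul_ne_zero (Complex.exp_ne_zero _) ?_
    rw [Complex.cpow_def_of_ne_zero (Complex.slitPlane_ne_zero hπA)]
    exact Complex.exp_ne_zero _
  have hquot := key.div hden hne
  rw [div_self hne] at hquot
  have hHpos : ∀ᶠ p : ℕ × ℂ in atTop ×ˢ 𝓝 z₀, 0 < dilogHeight p.2 :=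
    ((continuousAt_dilogHeight hz1).tendsto.comp hz).eventually_const_lt hD0
  refine hquot.congr' ?_
  filter_upwards [hh0, hn, hHpos] with p hp hnp hHp
  rw [Pi.div_apply, mainTerm_eq hHp hj0 hp hnp, Complex.exp_neg]
  push_cast
  simp only [div_eq_mul_inv, mul_inv, inv_inv]
  ring

theorem mainTheorem6 (a j : ℕ) (ha : 0 < a) (haj : a < j) (hj : 2 < j) (hcop : a.Coprime j) :
    -- asymptotics in the principal sector, uniform on compact sets
    (∀ X : Set ℂ, IsCompact X → X ⊆ openSector j →
      TendstoUniformlyOn (fun (n : ℕ) (z : ℂ) => weightedPartitionCount a j n z / mainTerm a j n z)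
        (fun _ => 1) atTop X) ∧
    -- the rotation identity
    (∀ (n : ℕ) (z : ℂ),
      weightedPartitionCount a j n (Complex.exp (2 * Real.pi * Complex.I * a / j) * z) =
        Complex.exp (2 * Real.pi * Complex.I * n / j) * weightedPartitionCount a j n z) ∧
    -- asymptotics in the rotated sectors, uniform on compact sets
    (∀ (t : ℤ) (X : Set ℂ), IsCompact X →
      (∀ z ∈ X, Complex.exp (-(2 * Real.pi * Complex.I * t * a / j)) * z ∈ openSector j) →
      TendstoUniformlyOn
        (fun (n : ℕ) (z : ℂ) => weightedPartitionCount a j n z /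
          (Complex.exp (2 * Real.pi * Complex.I * t * n / j) *
            mainTerm a j n (Complex.exp (-(2 * Real.pi * Complex.I * t * a / j)) * z)))
        (fun _ => 1) atTop X) := by
  have hj0 : 0 < j := ha.trans haj
  have part1 : ∀ X : Set ℂ, IsCompact X → X ⊆ openSector j →
      TendstoUniformlyOn (fun (n : ℕ) (z : ℂ) => weightedPartitionCount a j n z / mainTerm a j n z)
        (fun _ => 1) atTop X := by
    intro X hX hXs
    -- On a compact set uniform convergence is local, and locally it is the joint limit along `atTop
    -- ×ˢ 𝓝 z₀`.
    rw [← tendstoLocallyUniformlyOn_iff_tendstoUniformlyOn_of_compact hX,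
      tendstoLocallyUniformlyOn_iff_forall_tendsto]
    intro z₀ hz₀
    refine (Uniform.tendsto_nhds_right.1
      (tendsto_weightedPartitionCount_div_mainTerm ha haj hj hcop (hXs hz₀))).mono_left ?_
    exact prod_mono le_rfl nhdsWithin_le_nhds
  refine ⟨part1, fun n z => ?_, fun t X hX hXs => ?_⟩
  · simpa using weightedPartitionCount_rotation a hj0 n 1 z
  · have hg : Continuous fun z : ℂ => Complex.exp (-(2 * Real.pi * Complex.I * t * a / j)) * z := by
      fun_prop
    have h1 := (part1 _ (hX.image hg) (by rintro _ ⟨z, hz, rfl⟩; exact hXs z hz)).comp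
      fun z : ℂ => Complex.exp (-(2 * Real.pi * Complex.I * t * a / j)) * z
    refine (h1.mono (subset_preimage_image _ X)).congr (Eventually.of_forall fun n z _ => ?_)
    have h2 := weightedPartitionCount_rotation a hj0 n t
      (Complex.exp (-(2 * Real.pi * Complex.I * t * a / j)) * z)
    rw [← mul_assoc, ← Complex.exp_add, add_neg_cancel, Complex.exp_zero, one_mul] at h2
    simp only [Function.comp_apply]
    rw [h2, mul_div_mul_left _ _ (Complex.exp_ne_zero _)]
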